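/- Let $m\ge 1$. A shelf shuffle with $m$ shelves of a deck of $n$ cards, initially in the order $1,2,\dots,n$ from top to bottom, is the following: each card independently receives a uniformly random label in $\{1,\dots,2m\}$; the cards labeled $1$ are placed on top, in their original relative order; below them the cards labeled $2$, in reversed relative order; and so on, the odd-labeled packets keeping and the even-labeled packets reversing their relative order. For $w\in S_n$, let $P_m(w)$ be the probability that in the resulting deck the card in position $k$ from the top is $w(k)$ for every $k$. Let $N_i(w)$ be the number of $i$-cycles of $w$ (fixed points being the $1$-cycles), and for $i\ge 1$ let $$f_{i,m}=\frac1{2i}\sum_{\substack{d\mid i\\ d\text{ odd}}}\mu(d)(2m)^{i/d},$$ where $\mu$ is the Möbius function. Then each $f_{i,m}$ is a nonnegative integer, and, as formal power series in $u$ with coefficients polynomials over $\mathbb{Q}$ in the variables $x_1,x_2,\dots$, $$1+\sum_{n\ge1}u^n\sum_{w\in S_n}P_m(w)\prod_{i\ge1}x_i^{N_i(w)}=\prod_{i\ge1}\left(\frac{1+x_i(u/2m)^i}{1-x_i(u/2m)^i}\right)^{f_{i,m}},$$ where the infinite product converges coefficientwise (each coefficient of the partial products is eventually constant). -/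

import Mathlib

/-- The shelf shuffle with `m` shelves. The `n` cards are `Fin n`, initially in increasing order from
top to bottom, and `c` puts a label `0, 1, …, 2m - 1` on each card (the labels "one to `2m`" shifted
by one). The cards with label `0` come on top, in their original relative order, then
the cards with label `1` in reversed relative order, then those with label `2` in
their original relative order, and so on. The result is the shuffled deck, from top to bottom.
In machine terms, label `2s` means "put on top of the pile on shelf `s`" and label `2s + 1` means
"put at the bottom of the pile on shelf `s`", the cards being dealt from the bottom of the deck. -/
def shelfDeck {n m : ℕ} (c : Fin n → Fin (2 * m)) : List (Fin n) :=
  (List.finRange (2 * m)).flatMap fun j =>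
    if Even (j : ℕ) then (List.finRange n).filter (fun k => c k = j)
    else ((List.finRange n).filter (fun k => c k = j)).reverse

/-- The probability `P_m(w)` that the shelf shuffler with `m` shelves outputs `w` (so that `w k` is
the card in position `k` from the top), when the `n` labels are independent and uniform among the
`2m` labels. -/
def shelfProb (m : ℕ) {n : ℕ} (w : Equiv.Perm (Fin n)) : ℚ :=
  ((Finset.univ.filter fun c : Fin n → Fin (2 * m) => shelfDeck c = List.ofFn w).card : ℚ) /
    (2 * (m : ℚ)) ^ n

/-- `N_i(w)`, the number of `i`-cycles of `w`; the `1`-cycles are the fixed points. -/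
def numCycles {n : ℕ} (i : ℕ) (w : Equiv.Perm (Fin n)) : ℕ :=
  w.partition.parts.count i

/-- `f_{i,m} = (1 / 2i) ∑_{d ∣ i, d odd} μ(d) (2m)^{i/d}`. -/
def shelfExponent (i m : ℕ) : ℚ :=
  1 / (2 * (i : ℚ)) * ∑ d ∈ i.divisors.filter (fun d => Odd d),
    (ArithmeticFunction.moebius d : ℚ) * (2 * (m : ℚ)) ^ (i / d)

/-- Formal power series in `u` whose coefficients are polynomials over `ℚ` in variables `x_i`
(`i = 1, 2, …`; the variable `x_0` is never used). -/
abbrev CycleSeries : Type := PowerSeries (MvPolynomial ℕ ℚ)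

/-- `1 + ∑_{n ≥ 1} u^n ∑_{w ∈ S_n} P_m(w) ∏_{i ≥ 1} x_i^{N_i(w)}`. -/
noncomputable def shelfCycleSeries (m : ℕ) : CycleSeries :=
  1 + PowerSeries.mk fun n =>
    if n = 0 then 0
    else ∑ w : Equiv.Perm (Fin n),
      MvPolynomial.C (shelfProb m w) *
        ∏ i ∈ Finset.Icc 1 n, (MvPolynomial.X i : MvPolynomial ℕ ℚ) ^ numCycles i w

/-- `x_i (u / 2m)^i`. -/
noncomputable def cycleTerm (m i : ℕ) : CycleSeries :=
  PowerSeries.C (MvPolynomial.X i) *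
    (PowerSeries.C (MvPolynomial.C (1 / (2 * (m : ℚ)))) * PowerSeries.X) ^ i

/-- `(1 + x_i (u / 2m)^i) / (1 - x_i (u / 2m)^i)`, for `i ≥ 1`. -/
noncomputable def cycleFactor (m i : ℕ) : CycleSeries :=
  (1 + cycleTerm m i) * PowerSeries.invOfUnit (1 - cycleTerm m i) 1

/-- The division in `cycleFactor` is a genuine one. -/
theorem cycleFactor_mul (m i : ℕ) (hi : 1 ≤ i) :
    cycleFactor m i * (1 - cycleTerm m i) = 1 + cycleTerm m i := by
  have h : PowerSeries.constantCoeff (1 - cycleTerm m i) = ((1 : (MvPolynomial ℕ ℚ)ˣ) :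
      MvPolynomial ℕ ℚ) := by
    simp [cycleTerm, Nat.ne_of_gt hi]
  have h2 := PowerSeries.mul_invOfUnit (1 - cycleTerm m i) 1 h
  rw [cycleFactor, mul_assoc, mul_comm (PowerSeries.invOfUnit _ _), h2, mul_one]

/-- The infinite product `∏_i F i` of formal power series converges to `G` in the topology of
formal power series (discrete coefficients, coefficientwise convergence): each coefficient of the
finite partial products is eventually constant, and equal to that of `G`. -/
def HasFormalProd {R ι : Type*} [CommRing R] (F : ι → PowerSeries R) (G : PowerSeries R) : Prop :=
  letI : TopologicalSpace R := ⊥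
  letI : TopologicalSpace (PowerSeries R) := PowerSeries.WithPiTopology.instTopologicalSpace R
  HasProd F G

/-! The proof is a signed version of the Gessel–Reutenauer correspondence. Fix the labels `c` and
let `w` be the resulting deck, as the permutation that sorts the cards by label and then by signed
position (`shelfDeck_eq`). To each position `p` attach its itinerary, the periodic word of labels
met along `w p, w² p, …`. Its period can be taken to be any multiple `N` of `n!`. Moving from `p` to
`w p` shifts the word. When words are ordered lexicographically, with the comparison flipped after
each reversing letter, the itinerary is weakly increasing in `p` (`itinerary_mono`). A monotone map
is determined by its fiber sizes, so `c` is determined by a shift-invariant multiset of words, that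
is, by a multiset of shift orbits of total length `n`. Every such multiset occurs
(`itinerary_letter_symm_shift`, `sum_prod_load`).

The cycle type is read off orbit by orbit. Over a word in an orbit of length `i` lies a fiber of `r`
positions, and `w^i` maps this fiber to itself. If the orbit has an even number of reversing
letters, `w^i` is increasing on the fiber, hence the identity, and the orbit carries `r` cycles of
length `i`. Otherwise `w^i` reverses the fiber, which gives `r / 2` cycles of length `2i` and, for
odd `r`, one `i`-cycle. With `u` rescaled by `2m`, a positive orbit contributes `1 / (1 - x_i u^i)`
and a negative one `(1 + x_i u^i) / (1 - x_{2i} u^{2i})`.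

Let `P_i` and `Q_i` count the positive and negative orbits of length `i`. Counting the words fixed
by the `j`-th power of the shift, once plainly and once with signs, gives two divisor sums, with
values `(2m)^j` and `0`. Möbius inversion over odd divisors turns them into `Q_i = f_{i,m}`
(`card_negOrbits`) and `P_i + Q_{i/2} = Q_i` (`card_posOrbits_add`). So numerators and denominators
both occur with exponent `f_{i,m}`, which is a nonnegative integer because it is a cardinality. -/

/-! ### The shuffled deck as a sorting permutation. -/

/-- The orientation of a packet: `1` if it keeps its order, `-1` if it is reversed. -/
def letterSign {m : ℕ} (a : Fin (2 * m)) : ℤ := (-1) ^ (a : ℕ)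

theorem letterSign_of_even {m : ℕ} {a : Fin (2 * m)} (h : Even (a : ℕ)) : letterSign a = 1 :=
  h.neg_one_pow

theorem letterSign_of_not_even {m : ℕ} {a : Fin (2 * m)} (h : ¬ Even (a : ℕ)) :
    letterSign a = -1 :=
  (Nat.not_even_iff_odd.1 h).neg_one_pow

theorem letterSign_eq_or {m : ℕ} (a : Fin (2 * m)) : letterSign a = 1 ∨ letterSign a = -1 :=
  neg_one_pow_eq_or ℤ _

theorem sum_letterSign (m : ℕ) : ∑ a : Fin (2 * m), letterSign a = 0 := by
  simp only [letterSign]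
  rw [Fin.sum_univ_eq_sum_range (fun k => (-1 : ℤ) ^ k)]
  simp [neg_one_geom_sum]

/-- Cards are arranged in the shuffled deck by increasing `dealKey`. -/
def dealKey {n m : ℕ} (c : Fin n → Fin (2 * m)) (k : Fin n) : Fin (2 * m) ×ₗ ℤ :=
  toLex (c k, letterSign (c k) * ((k : ℕ) : ℤ))

theorem dealKey_lt_iff {n m : ℕ} (c : Fin n → Fin (2 * m)) (k l : Fin n) :
    dealKey c k < dealKey c l ↔ c k < c l ∨ c k = c l ∧
      letterSign (c k) * ((k : ℕ) : ℤ) < letterSign (c k) * ((l : ℕ) : ℤ) := by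
  rw [dealKey, dealKey, Prod.Lex.toLex_lt_toLex]
  constructor
  · rintro (h | ⟨h, h'⟩)
    · exact Or.inl h
    · dsimp only at h h'
      rw [← h] at h'
      exact Or.inr ⟨h, h'⟩
  · rintro (h | ⟨h, h'⟩)
    · exact Or.inl h
    · refine Or.inr ⟨h, ?_⟩
      dsimp only
      rwa [← h]

theorem dealKey_injective {n m : ℕ} (c : Fin n → Fin (2 * m)) :
    Function.Injective (dealKey c) := by
  intro k l h
  have h' := congrArg ofLex h
  simp only [dealKey, ofLex_toLex, Prod.mk.injEq] at h'
  obtain ⟨h1, h2⟩ := h'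
  rw [← h1] at h2
  rcases letterSign_eq_or (c k) with hs | hs <;> rw [hs] at h2 <;> ext <;> omega

/-- The deck produced by the labels `c`, as a permutation. -/
def shelfPerm {n m : ℕ} (c : Fin n → Fin (2 * m)) : Equiv.Perm (Fin n) :=
  Tuple.sort (dealKey c)

theorem strictMono_dealKey_shelfPerm {n m : ℕ} (c : Fin n → Fin (2 * m)) :
    StrictMono (dealKey c ∘ shelfPerm c) :=
  (Tuple.monotone_sort _).strictMono_of_injective
    ((dealKey_injective c).comp (shelfPerm c).injective)

theorem shelfPerm_lt {n m : ℕ} (c : Fin n → Fin (2 * m)) {p q : Fin n} (h : p < q) :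
    c (shelfPerm c p) < c (shelfPerm c q) ∨ c (shelfPerm c p) = c (shelfPerm c q) ∧
      letterSign (c (shelfPerm c p)) * ((shelfPerm c p : ℕ) : ℤ) <
        letterSign (c (shelfPerm c p)) * ((shelfPerm c q : ℕ) : ℤ) :=
  (dealKey_lt_iff c _ _).1 (strictMono_dealKey_shelfPerm c h)

theorem shelfDeck_eq_flatMap {n m : ℕ} (c : Fin n → Fin (2 * m)) :
    shelfDeck c = (List.finRange (2 * m)).flatMap fun j : Fin (2 * m) =>
      if Even (j : ℕ) then (List.finRange n).filter (fun k => c k = j)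
      else ((List.finRange n).filter (fun k => c k = j)).reverse := by
  simp only [shelfDeck, List.bind_eq_flatMap, List.pure_def, List.flatMap_assoc, Fin.ext_iff,
    List.flatMap_cons, List.flatMap_nil, List.append_nil]

theorem mem_shelfDeck {n m : ℕ} (c : Fin n → Fin (2 * m)) (k : Fin n) : k ∈ shelfDeck c := by
  rw [shelfDeck_eq_flatMap, List.mem_flatMap]
  refine ⟨c k, List.mem_finRange _, ?_⟩
  split_ifs <;> simp

theorem shelfDeck_pairwise {n m : ℕ} (c : Fin n → Fin (2 * m)) :
    (shelfDeck c).Pairwise (fun k l => dealKey c k < dealKey c l) := by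
  have hmem : ∀ (j : Fin (2 * m)) (k : Fin n),
      k ∈ (if Even (j : ℕ) then (List.finRange n).filter (fun k => c k = j)
        else ((List.finRange n).filter (fun k => c k = j)).reverse) → c k = j := by
    intro j k hk
    split_ifs at hk <;> simpa using hk
  have hlt : (List.finRange n).Pairwise (· < ·) := List.pairwise_lt_finRange n
  rw [shelfDeck_eq_flatMap, List.pairwise_flatMap]
  constructor
  · intro j _
    split_ifs with hj
    · refine List.Pairwise.imp_of_mem ?_ (hlt.filter _)
      intro k l hk hl h
      have hk' : c k = j := by simpa using hk
      have hl' : c l = j := by simpa using hl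
      rw [dealKey_lt_iff, hk', hl', letterSign_of_even hj]
      have : (k : ℕ) < l := h
      right; constructor
      · rfl
      · omega
    · rw [List.pairwise_reverse]
      refine List.Pairwise.imp_of_mem ?_ (hlt.filter _)
      intro k l hk hl h
      have hk' : c k = j := by simpa using hk
      have hl' : c l = j := by simpa using hl
      rw [dealKey_lt_iff, hk', hl', letterSign_of_not_even hj]
      have : (k : ℕ) < l := h
      right; constructor
      · rfl
      · omega
  · refine (List.pairwise_lt_finRange (2 * m)).imp ?_
    intro i j hij k hk l hl
    rw [dealKey_lt_iff, hmem i k hk, hmem j l hl]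
    exact Or.inl hij

/-- Both lists contain every card once and are strictly increasing in `dealKey`, so they coincide.
-/
theorem shelfDeck_eq {n m : ℕ} (c : Fin n → Fin (2 * m)) :
    shelfDeck c = List.ofFn (shelfPerm c) := by
  have h2 : (List.ofFn (shelfPerm c)).Pairwise (fun k l => dealKey c k < dealKey c l) :=
    List.pairwise_ofFn.2 fun i j hij => strictMono_dealKey_shelfPerm c hij
  have hnd : ∀ {l : List (Fin n)}, l.Pairwise (fun k l => dealKey c k < dealKey c l) →
      l.Nodup := fun h => h.imp (fun h e => by rw [e] at h; exact lt_irrefl _ h)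
  refine List.Perm.eq_of_pairwise (fun a b _ _ hab hba => (lt_asymm hab hba).elim)
    (shelfDeck_pairwise c) h2 ?_
  rw [List.perm_ext_iff_of_nodup (hnd (shelfDeck_pairwise c)) (hnd h2)]
  intro k
  simp only [mem_shelfDeck, true_iff, List.mem_ofFn]
  exact (shelfPerm c).surjective k

theorem shelfDeck_eq_ofFn_iff {n m : ℕ} (c : Fin n → Fin (2 * m)) (w : Equiv.Perm (Fin n)) :
    shelfDeck c = List.ofFn w ↔ shelfPerm c = w := by
  rw [shelfDeck_eq, List.ofFn_inj, DFunLike.coe_fn_eq]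

theorem sum_shelfProb_mul (m n : ℕ) (φ : Equiv.Perm (Fin n) → MvPolynomial ℕ ℚ) :
    ∑ w : Equiv.Perm (Fin n), MvPolynomial.C (shelfProb m w) * φ w =
      MvPolynomial.C ((1 / (2 * (m : ℚ))) ^ n) *
        ∑ c : Fin n → Fin (2 * m), φ (shelfPerm c) := by
  rw [← Finset.sum_fiberwise_of_maps_to (s := Finset.univ) (t := Finset.univ)
    (g := fun c : Fin n → Fin (2 * m) => shelfPerm c) (fun _ _ => Finset.mem_univ _),
    Finset.mul_sum]
  refine Finset.sum_congr rfl fun w _ => ?_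
  have h : ∑ c ∈ Finset.univ.filter (fun c : Fin n → Fin (2 * m) => shelfPerm c = w),
      φ (shelfPerm c) =
      ((Finset.univ.filter fun c : Fin n → Fin (2 * m) => shelfPerm c = w).card :
        MvPolynomial ℕ ℚ) * φ w := by
    rw [Finset.sum_congr rfl (g := fun _ => φ w), Finset.sum_const, nsmul_eq_mul]
    intro c hc
    rw [(Finset.mem_filter.1 hc).2]
  rw [h, ← mul_assoc, shelfProb]
  simp only [shelfDeck_eq_ofFn_iff]
  congr 1
  rw [← map_natCast (MvPolynomial.C (R := ℚ) (σ := ℕ)), ← map_mul]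
  congr 1
  rw [one_div, inv_pow, div_eq_mul_inv, mul_comm]

/-- Each coefficient of the cycle series is an average over words. -/
theorem coeff_shelfCycleSeries (m n : ℕ) :
    PowerSeries.coeff n (shelfCycleSeries m) =
      MvPolynomial.C ((1 / (2 * (m : ℚ))) ^ n) *
        ∑ c : Fin n → Fin (2 * m), ∏ i ∈ Finset.Icc 1 n,
          (MvPolynomial.X i : MvPolynomial ℕ ℚ) ^ numCycles i (shelfPerm c) := by
  rw [shelfCycleSeries, map_add, PowerSeries.coeff_mk, PowerSeries.coeff_one]
  by_cases hn : n = 0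
  · subst hn
    simp
  · rw [if_neg hn, if_neg hn, zero_add, sum_shelfProb_mul m n
      (fun w => ∏ i ∈ Finset.Icc 1 n,
        (MvPolynomial.X i : MvPolynomial ℕ ℚ) ^ numCycles i w)]

/-! ### Periodic words and their signed lexicographic order. -/

/-- Words of period `N` in the alphabet of the labels. They carry the signed lexicographic order, not the
pointwise one. -/
def PeriodicWord (m N : ℕ) : Type := ZMod N → Fin (2 * m)

namespace PeriodicWord

variable {m N : ℕ}

noncomputable instance [NeZero N] : Fintype (PeriodicWord m N) :=
  inferInstanceAs (Fintype (ZMod N → Fin (2 * m)))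

/-- The first letter. -/
def letter (e : PeriodicWord m N) : Fin (2 * m) := e 0

/-- The shift `e ↦ e (· + 1)`. -/
def shift : Equiv.Perm (PeriodicWord m N) where
  toFun e := fun k => e (k + 1)
  invFun e := fun k => e (k - 1)
  left_inv e := by funext k; simp
  right_inv e := by funext k; simp

theorem shift_apply (e : PeriodicWord m N) (k : ZMod N) : shift e k = e (k + 1) := rfl

theorem shift_pow_apply (j : ℕ) (e : PeriodicWord m N) (k : ZMod N) :
    (shift ^ j) e k = e (k + j) := by
  induction j generalizing k with
  | zero => simp
  | succ j ih =>
    rw [pow_succ', Equiv.Perm.mul_apply, shift_apply, ih]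
    push_cast
    ring_nf

theorem letter_shift_pow (j : ℕ) (e : PeriodicWord m N) : letter ((shift ^ j) e) = e j := by
  rw [letter, shift_pow_apply, zero_add]

/-- The letters of `e`, each one multiplied by the product of the signs of the preceding ones. -/
def twist (e : PeriodicWord m N) (k : ℕ) : ℤ :=
  (∏ l ∈ Finset.range k, letterSign (e l)) * ((e k : ℕ) : ℤ)

theorem twist_zero (e : PeriodicWord m N) : twist e 0 = ((letter e : ℕ) : ℤ) := by
  simp [twist, letter]

/-- This recursion drives every comparison: after equal first letters, the order of two words is
that of their shifts, reversed when the letter is reversing. -/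
theorem twist_succ (e : PeriodicWord m N) (k : ℕ) :
    twist e (k + 1) = letterSign (letter e) * twist (shift e) k := by
  simp only [twist, Finset.prod_range_succ', shift_apply, letter]
  push_cast
  ring

/-- The entry at `0` gives the first letter, hence its sign; dividing the sign out leaves the twist
of the shifted word, and so on. -/
theorem twist_injective [NeZero N] : Function.Injective (twist (m := m) (N := N)) := by
  have key : ∀ (k : ℕ) (e e' : PeriodicWord m N), twist e = twist e' → e k = e' k := by
    intro k
    induction k with
    | zero =>
      intro e e' h
      have h0 := congrFun h 0
      rw [twist_zero, twist_zero] at h0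
      simpa [letter, Fin.ext_iff] using h0
    | succ k ih =>
      intro e e' h
      have h0 : letter e = letter e' := by
        have h0 := congrFun h 0
        rw [twist_zero, twist_zero] at h0
        simpa [Fin.ext_iff] using h0
      have h1 : twist (shift e) = twist (shift e') := by
        funext j
        have h1 := congrFun h (j + 1)
        rw [twist_succ, twist_succ, ← h0] at h1
        rcases letterSign_eq_or (letter e) with hs | hs <;> rw [hs] at h1 <;> linarith
      have := ih _ _ h1
      rw [shift_apply, shift_apply] at this
      push_cast
      exact this
  intro e e' h
  funext k
  have := key k.val e e' h
  rwa [ZMod.natCast_zmod_val] at this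

noncomputable instance [NeZero N] : LinearOrder (PeriodicWord m N) :=
  LinearOrder.lift' (fun e => toLex (twist e))
    (fun _ _ h => twist_injective (toLex.injective h))

theorem lt_iff [NeZero N] (e e' : PeriodicWord m N) :
    e < e' ↔ ∃ k, (∀ l < k, twist e l = twist e' l) ∧ twist e k < twist e' k := Iff.rfl

theorem letter_mono [NeZero N] : Monotone (letter (m := m) (N := N)) := by
  intro e e' h
  by_contra! hlt
  refine not_lt.2 h ((lt_iff _ _).2 ⟨0, by simp, ?_⟩)
  rw [twist_zero, twist_zero]
  exact_mod_cast hlt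

theorem lt_of_shift_lt [NeZero N] {e e' : PeriodicWord m N} (h : letter e = letter e')
    (hs : letterSign (letter e) = 1) (hlt : shift e < shift e') : e < e' := by
  obtain ⟨k, hk, hk'⟩ := (lt_iff _ _).1 hlt
  refine (lt_iff _ _).2 ⟨k + 1, ?_, ?_⟩
  · rintro (_ | l) hl
    · rw [twist_zero, twist_zero, h]
    · rw [twist_succ, twist_succ, ← h, hk l (by omega)]
  · rw [twist_succ, twist_succ, ← h, hs]
    linarith

theorem lt_of_lt_shift [NeZero N] {e e' : PeriodicWord m N} (h : letter e = letter e')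
    (hs : letterSign (letter e) = -1) (hlt : shift e' < shift e) : e < e' := by
  obtain ⟨k, hk, hk'⟩ := (lt_iff _ _).1 hlt
  refine (lt_iff _ _).2 ⟨k + 1, ?_, ?_⟩
  · rintro (_ | l) hl
    · rw [twist_zero, twist_zero, h]
    · rw [twist_succ, twist_succ, ← h, hk l (by omega)]
  · rw [twist_succ, twist_succ, ← h, hs]
    linarith

end PeriodicWord

/-! ### Itineraries, and how they determine and realize the labels. -/

open PeriodicWord in
/-- The itinerary of the position `p` under the permutation `shelfPerm c`. -/
def itinerary {m n : ℕ} (N : ℕ) (c : Fin n → Fin (2 * m)) (p : Fin n) : PeriodicWord m N :=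
  fun k => c ((shelfPerm c ^ (k.val + 1)) p)

theorem Equiv.Perm.pow_factorial_eq_one {n : ℕ} (w : Equiv.Perm (Fin n)) {N : ℕ}
    (hN : n.factorial ∣ N) : w ^ N = 1 := by
  obtain ⟨k, rfl⟩ := hN
  rw [pow_mul]
  have : w ^ n.factorial = 1 := by
    have h := pow_card_eq_one (x := w)
    rwa [Fintype.card_perm, Fintype.card_fin] at h
  rw [this, one_pow]

/-- Since `n!` divides `N`, the `N`-th power of the shuffle is trivial, so the itinerary may be
indexed by any natural number instead of a residue. -/
theorem itinerary_natCast {m n N : ℕ} (hN : n.factorial ∣ N) (c : Fin n → Fin (2 * m))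
    (p : Fin n) (k : ℕ) : itinerary N c p (k : ZMod N) = c ((shelfPerm c ^ (k + 1)) p) := by
  rw [itinerary, ZMod.val_natCast, pow_succ, pow_succ,
    ← pow_eq_pow_mod k (Equiv.Perm.pow_factorial_eq_one (shelfPerm c) hN)]

open PeriodicWord

/-- The exponent `k + 1` in `itinerary` serves this purpose: the first letter is the label of the
card in position `p`, which is weakly increasing in `p`. -/
theorem letter_itinerary {m n N : ℕ} (hN : n.factorial ∣ N) (c : Fin n → Fin (2 * m)) (p : Fin n) :
    letter (itinerary N c p) = c (shelfPerm c p) := by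
  have := itinerary_natCast hN c p 0
  simpa [letter] using this

section

variable {m n N : ℕ} [NeZero N]

theorem itinerary_shelfPerm (hN : n.factorial ∣ N) (c : Fin n → Fin (2 * m)) (p : Fin n) :
    itinerary N c (shelfPerm c p) = shift (itinerary N c p) := by
  funext k
  obtain ⟨j, rfl⟩ : ∃ j : ℕ, (j : ZMod N) = k := ⟨k.val, ZMod.natCast_zmod_val k⟩
  have := itinerary_natCast hN c p (j + 1)
  rw [Nat.cast_add, Nat.cast_one] at this
  rw [shift_apply, this, itinerary_natCast hN, pow_succ _ (j + 1), Equiv.Perm.mul_apply]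

theorem shelfPerm_lt_of_even (c : Fin n → Fin (2 * m)) {p q : Fin n} (h : p < q)
    (hc : c (shelfPerm c p) = c (shelfPerm c q)) (hs : letterSign (c (shelfPerm c p)) = 1) :
    shelfPerm c p < shelfPerm c q := by
  rcases shelfPerm_lt c h with h1 | ⟨-, h2⟩
  · exact absurd hc h1.ne
  · rw [hs] at h2
    rw [Fin.lt_def]
    omega

theorem shelfPerm_lt_of_odd (c : Fin n → Fin (2 * m)) {p q : Fin n} (h : p < q)
    (hc : c (shelfPerm c p) = c (shelfPerm c q)) (hs : letterSign (c (shelfPerm c p)) = -1) :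
    shelfPerm c q < shelfPerm c p := by
  rcases shelfPerm_lt c h with h1 | ⟨-, h2⟩
  · exact absurd hc h1.ne
  · rw [hs] at h2
    rw [Fin.lt_def]
    omega

theorem label_shelfPerm_mono (c : Fin n → Fin (2 * m)) : Monotone (c ∘ shelfPerm c) := by
  intro p q h
  rcases h.lt_or_eq with h | rfl
  · rcases shelfPerm_lt c h with h1 | ⟨h1, -⟩
    exacts [h1.le, h1.le]
  · exact le_rfl

/-- Induction on the index up to which the twisted words agree. With equal first letters, the
shuffle keeps or reverses the order of the two positions according to the sign of the letter, and
the twist of the shifts is multiplied by the same sign; the two effects cancel. -/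
theorem itinerary_mono (hN : n.factorial ∣ N) (c : Fin n → Fin (2 * m)) :
    Monotone (itinerary N c) := by
  have key : ∀ (k : ℕ) (p q : Fin n), p < q →
      (∀ l < k, twist (itinerary N c p) l = twist (itinerary N c q) l) →
      twist (itinerary N c p) k ≤ twist (itinerary N c q) k := by
    intro k
    induction k with
    | zero =>
      intro p q h _
      rw [twist_zero, twist_zero, letter_itinerary hN, letter_itinerary hN]
      exact_mod_cast label_shelfPerm_mono c h.le
    | succ k ih =>
      intro p q h hl
      have h0 := hl 0 (Nat.succ_pos k)
      rw [twist_zero, twist_zero, letter_itinerary hN, letter_itinerary hN] at h0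
      have h0 : c (shelfPerm c p) = c (shelfPerm c q) := Fin.ext (by exact_mod_cast h0)
      have ht : ∀ (r : Fin n) (l : ℕ), c (shelfPerm c p) = c (shelfPerm c r) →
          twist (itinerary N c r) (l + 1) = letterSign (c (shelfPerm c p)) *
            twist (itinerary N c (shelfPerm c r)) l := by
        intro r l hr
        rw [twist_succ, letter_itinerary hN, itinerary_shelfPerm hN, hr]
      have hl' : ∀ l < k, letterSign (c (shelfPerm c p)) *
            twist (itinerary N c (shelfPerm c p)) l = letterSign (c (shelfPerm c p)) *
            twist (itinerary N c (shelfPerm c q)) l := by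
        intro l hlk
        rw [← ht p l rfl, ← ht q l h0]
        exact hl _ (by omega)
      rw [ht p k rfl, ht q k h0]
      rcases letterSign_eq_or (c (shelfPerm c p)) with hs | hs
      · rw [hs] at hl' ⊢
        have := ih _ _ (shelfPerm_lt_of_even c h h0 hs) (fun l hl => by linarith [hl' l hl])
        linarith
      · rw [hs] at hl' ⊢
        have := ih _ _ (shelfPerm_lt_of_odd c h h0 hs) (fun l hl => by linarith [hl' l hl])
        linarith
  intro p q h
  rcases h.lt_or_eq with h | rfl
  · by_contra! hlt
    obtain ⟨k, hk, hk'⟩ := (lt_iff _ _).1 hlt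
    exact absurd (key k p q h fun l hl => (hk l hl).symm) (not_le.2 hk')
  · exact le_rfl

/-- The itinerary is the only map to words that intertwines the shuffle with the shift and has the
right first letters. -/
theorem eq_itinerary (hN : n.factorial ∣ N) (c : Fin n → Fin (2 * m))
    (π : Fin n → PeriodicWord m N) (h1 : ∀ p, π (shelfPerm c p) = shift (π p))
    (h2 : ∀ p, letter (π p) = c (shelfPerm c p)) : π = itinerary N c := by
  have hpow : ∀ (j : ℕ) (p : Fin n), π ((shelfPerm c ^ j) p) = (shift ^ j) (π p) := by
    intro j
    induction j with
    | zero => simp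
    | succ j ih =>
      intro p
      rw [pow_succ', pow_succ', Equiv.Perm.mul_apply, Equiv.Perm.mul_apply, h1, ih]
  funext p k
  obtain ⟨j, rfl⟩ : ∃ j : ℕ, (j : ZMod N) = k := ⟨k.val, ZMod.natCast_zmod_val k⟩
  have h := letter_shift_pow j (π p)
  rw [← hpow, h2, ← Equiv.Perm.mul_apply, ← pow_succ'] at h
  rw [itinerary_natCast hN]
  exact h.symm

theorem Monotone.eq_of_card_fiber_eq {α : Type*} [LinearOrder α] {f g : Fin n → α}
    (hf : Monotone f) (hg : Monotone g)
    (h : ∀ a, (Finset.univ.filter fun p => f p = a).card =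
      (Finset.univ.filter fun p => g p = a).card) : f = g := by
  have hcount : ∀ (k : Fin n → α) (a : α),
      (List.ofFn k).count a = (Finset.univ.filter fun p => k p = a).card := by
    intro k a
    rw [← Multiset.coe_count, List.ofFn_eq_map, ← Multiset.map_coe]
    have : ((List.finRange n : List (Fin n)) : Multiset (Fin n)) = Finset.univ.val := rfl
    rw [this, Multiset.count_map]
    simp only [Finset.card, Finset.filter_val, eq_comm]
  have := List.Perm.eq_of_sortedLE (List.sortedLE_ofFn_iff.2 hf) (List.sortedLE_ofFn_iff.2 hg)
    (List.perm_iff_count.2 fun a => by rw [hcount, hcount, h])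
  exact List.ofFn_injective this

/-- The shuffle maps the fiber over `e` bijectively onto the fiber over `shift e`. -/
theorem card_itinerary_shift (hN : n.factorial ∣ N) (c : Fin n → Fin (2 * m))
    (e : PeriodicWord m N) :
    (Finset.univ.filter fun p => itinerary N c p = shift e).card =
      (Finset.univ.filter fun p => itinerary N c p = e).card := by
  symm
  refine Finset.card_bij (fun p _ => shelfPerm c p) ?_ ?_ ?_
  · intro p hp
    simp only [Finset.mem_filter, Finset.mem_univ, true_and] at hp ⊢
    rw [itinerary_shelfPerm hN, hp]
  · intro p _ q _ h
    exact (shelfPerm c).injective h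
  · intro q hq
    simp only [Finset.mem_filter, Finset.mem_univ, true_and] at hq
    refine ⟨(shelfPerm c).symm q, ?_, by simp⟩
    simp only [Finset.mem_filter, Finset.mem_univ, true_and]
    apply shift.injective
    rw [← itinerary_shelfPerm hN, Equiv.apply_symm_apply, hq]

theorem label_eq_letter_symm_shift (hN : n.factorial ∣ N) (c : Fin n → Fin (2 * m))
    (p : Fin n) : letter (shift.symm (itinerary N c p)) = c p := by
  obtain ⟨q, rfl⟩ := (shelfPerm c).surjective p
  rw [itinerary_shelfPerm hN, Equiv.symm_apply_apply, letter_itinerary hN]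

theorem itinerary_injective (hN : n.factorial ∣ N) :
    Function.Injective (itinerary (m := m) (n := n) N) := by
  intro c c' h
  funext p
  rw [← label_eq_letter_symm_shift hN c, h, label_eq_letter_symm_shift hN c']

/-- Surjectivity of the correspondence: the labels are forced by `label_eq_letter_symm_shift`. With
them, `p ↦ shift⁻¹ (π (w p))` is again monotone and has the fiber sizes of `π`, so it equals `π`.
Thus `π` intertwines `w` with the shift, and uniqueness of the itinerary applies. -/
theorem itinerary_letter_symm_shift (hN : n.factorial ∣ N) {π : Fin n → PeriodicWord m N}
    (hπ : Monotone π)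
    (h : ∀ e, (Finset.univ.filter fun p => π p = shift e).card =
      (Finset.univ.filter fun p => π p = e).card) :
    itinerary N (fun p => letter (shift.symm (π p))) = π := by
  set c : Fin n → Fin (2 * m) := fun p => letter (shift.symm (π p)) with hc
  have hmono : Monotone fun p => shift.symm (π (shelfPerm c p)) := by
    intro p q hpq
    rcases hpq.lt_or_eq with hpq | rfl
    swap
    · exact le_rfl
    -- An inversion would force equal letters. The sign then fixes the order of `w p` and `w q`,
    -- monotonicity of `π` orders the shifted words accordingly, and prefixing the common letter
    -- contradicts the inversion.
    by_contra! hlt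
    have h1 : c (shelfPerm c p) = c (shelfPerm c q) :=
      le_antisymm (label_shelfPerm_mono c hpq.le) (letter_mono hlt.le)
    have hmem : letter (shift.symm (π (shelfPerm c p))) =
      letter (shift.symm (π (shelfPerm c q))) := h1
    rcases letterSign_eq_or (c (shelfPerm c p)) with hs | hs
    · have h2 := hπ (shelfPerm_lt_of_even c hpq h1 hs).le
      rcases h2.lt_or_eq with h2 | h2
      · refine lt_asymm hlt (lt_of_shift_lt hmem hs ?_)
        simpa using h2
      · rw [h2] at hlt
        exact lt_irrefl _ hlt
    · have h2 := hπ (shelfPerm_lt_of_odd c hpq h1 hs).le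
      rcases h2.lt_or_eq with h2 | h2
      · refine lt_asymm hlt (lt_of_lt_shift hmem hs ?_)
        simpa using h2
      · rw [h2] at hlt
        exact lt_irrefl _ hlt
  have heq : (fun p => shift.symm (π (shelfPerm c p))) = π := by
    refine hmono.eq_of_card_fiber_eq hπ fun e => ?_
    rw [← h e]
    refine Finset.card_bij (fun p _ => shelfPerm c p) ?_ ?_ ?_
    · intro p hp
      simp only [Finset.mem_filter, Finset.mem_univ, true_and] at hp ⊢
      rw [← hp, Equiv.apply_symm_apply]
    · intro p _ q _ h
      exact (shelfPerm c).injective h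
    · intro q hq
      simp only [Finset.mem_filter, Finset.mem_univ, true_and] at hq
      refine ⟨(shelfPerm c).symm q, ?_, by simp⟩
      simp [hq]
  symm
  refine eq_itinerary hN c π (fun p => ?_) fun p => ?_
  · rw [← congrFun heq p, Equiv.apply_symm_apply]
  · exact (congrArg letter (congrFun heq p)).symm

end

open Function (minimalPeriod)

/-! ### Cycle counts through minimal periods. -/

section PermCycles

variable {α : Type*} [Fintype α] [DecidableEq α]

theorem Equiv.Perm.isPeriodicPt_iff {α : Type*} (w : Equiv.Perm α) (k : ℕ) (p : α) :
    Function.IsPeriodicPt w k p ↔ (w ^ k) p = p := by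
  rw [Function.IsPeriodicPt, Function.IsFixedPt, Equiv.Perm.iterate_eq_pow]

theorem Equiv.Perm.minimalPeriod_pos {α : Type*} [Finite α] (w : Equiv.Perm α) (p : α) :
    0 < minimalPeriod w p := by
  refine Function.IsPeriodicPt.minimalPeriod_pos (orderOf_pos w) ?_
  rw [Equiv.Perm.isPeriodicPt_iff, pow_orderOf_eq_one, Equiv.Perm.one_apply]

theorem Equiv.Perm.minimalPeriod_eq_card_support_cycleOf (w : Equiv.Perm α) {p : α}
    (hp : p ∈ w.support) : minimalPeriod w p = (w.cycleOf p).support.card := by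
  have hmem : p ∈ (w.cycleOf p).support := by
    rw [Equiv.Perm.mem_support_cycleOf_iff]
    exact ⟨Equiv.Perm.SameCycle.refl _ _, hp⟩
  have key : ∀ k, Function.IsPeriodicPt w k p ↔ (w.cycleOf p).support.card ∣ k := fun k => by
    rw [Equiv.Perm.isPeriodicPt_iff,
      (Equiv.Perm.isCycleOn_support_cycleOf w p).pow_apply_eq (by exact_mod_cast hmem)]
  exact Nat.dvd_antisymm ((key _).2 dvd_rfl).minimalPeriod_dvd
    ((key _).1 (Function.isPeriodicPt_minimalPeriod _ _))

/-- Lets cycles be counted pointwise, and hence fiber by fiber. Fixed points are treated apart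
because `cycleType` omits them. -/
theorem numCycles_mul {n : ℕ} (w : Equiv.Perm (Fin n)) {j : ℕ} (hj : 1 ≤ j) :
    j * numCycles j w = (Finset.univ.filter fun p => minimalPeriod w p = j).card := by
  rw [numCycles, Equiv.Perm.parts_partition, Multiset.count_add, Multiset.count_replicate]
  rcases hj.eq_or_lt with rfl | hj
  · have h0 : Multiset.count 1 w.cycleType = 0 := by
      rw [Multiset.count_eq_zero]
      intro h
      exact lt_irrefl _ (Equiv.Perm.one_lt_of_mem_cycleType h)
    rw [h0, if_pos rfl, zero_add, one_mul, ← Finset.card_compl]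
    congr 1
    ext p
    simp [Function.minimalPeriod_eq_one_iff_isFixedPt, Function.IsFixedPt]
  · rw [if_neg hj.ne, add_zero, Equiv.Perm.cycleType_def, Multiset.count_map]
    have hfix : ∀ p, minimalPeriod w p = j → p ∈ w.support := by
      intro p hp
      rw [Equiv.Perm.mem_support]
      intro h
      rw [Function.minimalPeriod_eq_one_iff_isFixedPt.2 h] at hp
      omega
    rw [Finset.card_eq_sum_card_fiberwise (f := fun p => w.cycleOf p)
      (t := w.cycleFactorsFinset.filter fun c => j = c.support.card)]
    · rw [Finset.sum_congr rfl (g := fun _ => j)]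
      · rw [Finset.sum_const, smul_eq_mul, mul_comm]
        rfl
      · intro c hc
        obtain ⟨hc, hcj⟩ := Finset.mem_filter.1 hc
        rw [hcj]
        congr 1
        ext p
        rw [Finset.mem_filter, Finset.mem_filter]
        constructor
        · rintro ⟨⟨-, h⟩, rfl⟩
          rw [Equiv.Perm.mem_support_cycleOf_iff]
          exact ⟨Equiv.Perm.SameCycle.refl _ _, hfix p (h.trans hcj.symm)⟩
        · intro hp
          have hcyc := Equiv.Perm.cycle_is_cycleOf hp hc
          refine ⟨⟨Finset.mem_univ _, ?_⟩, hcyc.symm⟩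
          rw [Equiv.Perm.minimalPeriod_eq_card_support_cycleOf w
            (Equiv.Perm.mem_cycleFactorsFinset_support_le hc hp), ← hcyc]
    · intro p hp
      have hp' : minimalPeriod w p = j := by simpa using hp
      simp only [Finset.coe_filter, Set.mem_ofPred_eq]
      exact ⟨Equiv.Perm.cycleOf_mem_cycleFactorsFinset_iff.2 (hfix p hp'),
        by rw [← Equiv.Perm.minimalPeriod_eq_card_support_cycleOf w (hfix p hp'), hp']⟩

/-- If `f p ≠ p`, the iterates of `p` form a strictly monotone sequence, which a finite type cannot
contain. -/
theorem Equiv.Perm.eq_self_of_monotone_on {α : Type*} [LinearOrder α] [Finite α]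
    (f : Equiv.Perm α) (F : Set α) (hF : ∀ p ∈ F, f p ∈ F)
    (h : ∀ p ∈ F, ∀ q ∈ F, p < q → f p < f q) {p : α} (hp : p ∈ F) : f p = p := by
  have hmem : ∀ k, (f ^ k) p ∈ F := by
    intro k
    induction k with
    | zero => simpa using hp
    | succ k ih => rw [pow_succ', Equiv.Perm.mul_apply]; exact hF _ ih
  have hs : ∀ k, (f ^ (k + 1)) p = f ((f ^ k) p) := fun k => by
    rw [pow_succ', Equiv.Perm.mul_apply]
  rcases lt_trichotomy (f p) p with hlt | heq | hlt
  · have : StrictAnti fun k => (f ^ k) p := by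
      refine strictAnti_nat_of_succ_lt fun k => ?_
      induction k with
      | zero => simpa using hlt
      | succ k ih =>
        rw [hs (k + 1), hs k]
        have := h _ (hmem _) _ (hmem _) ih
        rwa [hs k] at this
    exact absurd this.injective (not_injective_infinite_finite _)
  · exact heq
  · have : StrictMono fun k => (f ^ k) p := by
      refine strictMono_nat_of_lt_succ fun k => ?_
      induction k with
      | zero => simpa using hlt
      | succ k ih =>
        rw [hs (k + 1), hs k]
        have := h _ (hmem _) _ (hmem _) ih
        rwa [hs k] at this
    exact absurd this.injective (not_injective_infinite_finite _)

end PermCycles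

/-! ### Cycles lying over one fiber of a signed semiconjugacy. -/

/-- `π` semiconjugates `w` to `S`, and on each fiber of `π` the permutation `w` is increasing or
decreasing according to the sign `s`. -/
structure IsFiberMonotone {n : ℕ} {E : Type*} (w : Equiv.Perm (Fin n)) (S : Equiv.Perm E)
    (π : Fin n → E) (s : E → ℤ) : Prop where
  map_apply : ∀ p, π (w p) = S (π p)
  sign : ∀ e, s e = 1 ∨ s e = -1
  lt_of_one : ∀ p q, p < q → π p = π q → s (π p) = 1 → w p < w q
  lt_of_neg_one : ∀ p q, p < q → π p = π q → s (π p) = -1 → w q < w p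

namespace IsFiberMonotone

variable {n : ℕ} {E : Type*} {w : Equiv.Perm (Fin n)} {S : Equiv.Perm E} {π : Fin n → E}
  {s : E → ℤ} (H : IsFiberMonotone w S π s)
include H

theorem map_pow_apply (k : ℕ) (p : Fin n) : π ((w ^ k) p) = (S ^ k) (π p) := by
  induction k with
  | zero => simp
  | succ k ih =>
    rw [pow_succ', pow_succ', Equiv.Perm.mul_apply, Equiv.Perm.mul_apply, H.map_apply, ih]

theorem prod_sign (e : E) (k : ℕ) :
    ∏ l ∈ Finset.range k, s ((S ^ l) e) = 1 ∨ ∏ l ∈ Finset.range k, s ((S ^ l) e) = -1 := by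
  induction k with
  | zero => simp
  | succ k ih =>
    rw [Finset.prod_range_succ]
    rcases ih with h | h <;> rcases H.sign ((S ^ k) e) with h' | h' <;> simp [h, h']

/-- Two points of one fiber stay in a common fiber, and each application of `w` keeps or flips their
order by the sign of the current word. -/
theorem pow_lt (k : ℕ) {p q : Fin n} (hpq : p < q) (h : π p = π q) :
    (∏ l ∈ Finset.range k, s ((S ^ l) (π p)) = 1 → (w ^ k) p < (w ^ k) q) ∧
    (∏ l ∈ Finset.range k, s ((S ^ l) (π p)) = -1 → (w ^ k) q < (w ^ k) p) := by
  induction k with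
  | zero => simpa using hpq
  | succ k ih =>
    rw [Finset.prod_range_succ, pow_succ', Equiv.Perm.mul_apply, Equiv.Perm.mul_apply,
      ← H.map_pow_apply]
    have hk : π ((w ^ k) p) = π ((w ^ k) q) := by rw [H.map_pow_apply, H.map_pow_apply, h]
    rcases H.prod_sign (π p) k with h1 | h1
    · have hlt := ih.1 h1
      rw [h1, one_mul]
      exact ⟨H.lt_of_one _ _ hlt hk, H.lt_of_neg_one _ _ hlt hk⟩
    · have hlt := ih.2 h1
      rw [h1, hk]
      refine ⟨fun h2 => H.lt_of_neg_one _ _ hlt hk.symm (by linarith),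
        fun h2 => H.lt_of_one _ _ hlt hk.symm (by linarith)⟩

theorem minimalPeriod_dvd (p : Fin n) : minimalPeriod S (π p) ∣ minimalPeriod w p := by
  refine Function.IsPeriodicPt.minimalPeriod_dvd ?_
  rw [Equiv.Perm.isPeriodicPt_iff, ← H.map_pow_apply,
    (Equiv.Perm.isPeriodicPt_iff _ _ _).1 (Function.isPeriodicPt_minimalPeriod w p)]

theorem pow_minimalPeriod_mem (p : Fin n) : π ((w ^ minimalPeriod S (π p)) p) = π p := by
  rw [H.map_pow_apply, (Equiv.Perm.isPeriodicPt_iff _ _ _).1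
    (Function.isPeriodicPt_minimalPeriod S (π p))]

theorem minimalPeriod_eq (p : Fin n)
    (hs : ∏ l ∈ Finset.range (minimalPeriod S (π p)), s ((S ^ l) (π p)) = 1) :
    minimalPeriod w p = minimalPeriod S (π p) := by
  refine Nat.dvd_antisymm (Function.IsPeriodicPt.minimalPeriod_dvd ?_) (H.minimalPeriod_dvd p)
  rw [Equiv.Perm.isPeriodicPt_iff]
  refine Equiv.Perm.eq_self_of_monotone_on _ {q | π q = π p} (fun q hq => ?_)
    (fun q hq q' hq' hlt => ?_) rfl
  · have := H.pow_minimalPeriod_mem q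
    rw [Set.mem_ofPred_eq] at hq ⊢
    rwa [hq] at this
  · rw [Set.mem_ofPred_eq] at hq hq'
    refine (H.pow_lt _ hlt (hq.trans hq'.symm)).1 ?_
    rwa [hq]

/-- The return map to the fiber is increasing or decreasing; in either case its square is
increasing, hence the identity there. -/
theorem minimalPeriod_dvd_two_mul (p : Fin n) :
    minimalPeriod w p ∣ 2 * minimalPeriod S (π p) := by
  refine Function.IsPeriodicPt.minimalPeriod_dvd ?_
  rw [Equiv.Perm.isPeriodicPt_iff, mul_comm, pow_mul]
  set f := w ^ minimalPeriod S (π p) with hf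
  have hF : ∀ q, π q = π p → π (f q) = π p := fun q hq => by
    have := H.pow_minimalPeriod_mem q
    rwa [hq] at this
  have hF2 : ∀ q, π q = π p → π ((f ^ 2) q) = π p := fun q hq => by
    rw [pow_two, Equiv.Perm.mul_apply]
    exact hF _ (hF _ hq)
  refine Equiv.Perm.eq_self_of_monotone_on _ {q | π q = π p} hF2 (fun q hq q' hq' hlt => ?_) rfl
  rw [Set.mem_ofPred_eq] at hq hq'
  rw [pow_two, Equiv.Perm.mul_apply, Equiv.Perm.mul_apply]
  rcases H.prod_sign (π p) (minimalPeriod S (π p)) with h1 | h1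
  · have h2 := (H.pow_lt (minimalPeriod S (π p)) hlt (hq.trans hq'.symm)).1 (by rwa [hq])
    exact (H.pow_lt (minimalPeriod S (π p)) h2 ((hF _ hq).trans (hF _ hq').symm)).1
      (by rwa [← hf, hF _ hq])
  · have h2 := (H.pow_lt (minimalPeriod S (π p)) hlt (hq.trans hq'.symm)).2 (by rwa [hq])
    exact (H.pow_lt (minimalPeriod S (π p)) h2 ((hF _ hq').trans (hF _ hq).symm)).2
      (by rwa [← hf, hF _ hq'])

variable [DecidableEq E]

theorem card_filter_of_one (e : E) (j : ℕ)
    (hs : ∏ l ∈ Finset.range (minimalPeriod S e), s ((S ^ l) e) = 1) :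
    (Finset.univ.filter fun p => π p = e ∧ minimalPeriod w p = j).card =
      if j = minimalPeriod S e then (Finset.univ.filter fun p => π p = e).card else 0 := by
  have : ∀ p, π p = e → minimalPeriod w p = minimalPeriod S e := by
    rintro p rfl
    exact H.minimalPeriod_eq p hs
  split_ifs with hj
  · congr 1
    refine Finset.filter_congr fun p _ => ⟨fun h => h.1, fun h => ⟨h, ?_⟩⟩
    rw [this p h, hj]
  · rw [Finset.card_eq_zero, Finset.filter_eq_empty_iff]
    rintro p - ⟨h, h'⟩
    exact hj (by rw [← h', this p h])

/-- The return map is a decreasing involution of the fiber: at most one fixed point, all other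
points in pairs, so parity alone decides the counts. -/
theorem card_filter_of_neg_one [Finite E] (e : E) (j : ℕ)
    (hs : ∏ l ∈ Finset.range (minimalPeriod S e), s ((S ^ l) e) = -1) :
    (Finset.univ.filter fun p => π p = e ∧ minimalPeriod w p = j).card =
      (if j = minimalPeriod S e then (Finset.univ.filter fun p => π p = e).card % 2 else 0) +
      if j = 2 * minimalPeriod S e then 2 * ((Finset.univ.filter fun p => π p = e).card / 2)
        else 0 := by
  set i := minimalPeriod S e with hi
  have hi0 : 0 < i := S.minimalPeriod_pos e
  set F := Finset.univ.filter fun p => π p = e with hF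
  have hper : ∀ p, π p = e → minimalPeriod w p = i ∨ minimalPeriod w p = 2 * i := by
    rintro p rfl
    obtain ⟨k, hk⟩ := H.minimalPeriod_dvd p
    have h2 := H.minimalPeriod_dvd_two_mul p
    rw [← hi] at hk h2
    rw [hk, mul_comm 2 i, Nat.mul_dvd_mul_iff_left hi0, Nat.dvd_prime Nat.prime_two] at h2
    rcases h2 with rfl | rfl
    · exact Or.inl (by rw [hk, mul_one])
    · exact Or.inr (by rw [hk, mul_comm])
  have hfix : ∀ p, π p = e → (minimalPeriod w p = i ↔ (w ^ i) p = p) := by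
    intro p hp
    rw [← Equiv.Perm.isPeriodicPt_iff, Function.isPeriodicPt_iff_minimalPeriod_dvd]
    refine ⟨fun h => h.dvd, fun h => Nat.dvd_antisymm h ?_⟩
    rw [hi, ← hp]
    exact H.minimalPeriod_dvd p
  have hle : (F.filter fun p => (w ^ i) p = p).card ≤ 1 := by
    rw [Finset.card_le_one]
    intro p hp q hq
    simp only [hF, Finset.mem_filter, Finset.mem_univ, true_and] at hp hq
    by_contra hne
    rcases lt_or_gt_of_ne hne with hlt | hlt
    · have := (H.pow_lt i hlt (hp.1.trans hq.1.symm)).2 (by rwa [hp.1])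
      rw [hp.2, hq.2] at this
      exact lt_asymm hlt this
    · have := (H.pow_lt i hlt (hq.1.trans hp.1.symm)).2 (by rwa [hq.1])
      rw [hp.2, hq.2] at this
      exact lt_asymm hlt this
  have heven : 2 ∣ (F.filter fun p => ¬ (w ^ i) p = p).card := by
    rw [← CharP.cast_eq_zero_iff (ZMod 2) 2, Finset.cast_card]
    -- Modulo `2` the non-fixed points cancel in pairs under `w ^ i`.
    refine Finset.sum_involution (fun p _ => (w ^ i) p) (fun _ _ => by decide)
      (fun p hp _ => (Finset.mem_filter.1 hp).2) (fun p hp => ?_) (fun p hp => ?_)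
    · simp only [hF, Finset.mem_filter, Finset.mem_univ, true_and] at hp ⊢
      obtain ⟨hp, hp'⟩ := hp
      refine ⟨?_, fun h => hp' ((w ^ i).injective h)⟩
      have := H.pow_minimalPeriod_mem p
      rwa [hp] at this
    · simp only [hF, Finset.mem_filter, Finset.mem_univ, true_and] at hp
      have := H.minimalPeriod_dvd_two_mul p
      rw [hp.1, ← hi, ← Function.isPeriodicPt_iff_minimalPeriod_dvd,
        Equiv.Perm.isPeriodicPt_iff, two_mul, pow_add, Equiv.Perm.mul_apply] at this
      exact this
  have hsum := Finset.card_filter_add_card_filter_not (s := F) (fun p => (w ^ i) p = p)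
  have hmain : (Finset.univ.filter fun p => π p = e ∧ minimalPeriod w p = j).card =
      (if j = i then (F.filter fun p => (w ^ i) p = p).card else 0) +
      if j = 2 * i then (F.filter fun p => ¬ (w ^ i) p = p).card else 0 := by
    rw [← Finset.filter_filter, ← hF]
    split_ifs with h1 h2 h2
    · omega
    · rw [add_zero]
      congr 1
      refine Finset.filter_congr fun p hp => ?_
      rw [h1, hfix p (Finset.mem_filter.1 hp).2]
    · rw [zero_add]
      congr 1
      refine Finset.filter_congr fun p hp => ?_
      have hp := (Finset.mem_filter.1 hp).2
      rw [← hfix p hp, h2]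
      rcases hper p hp with h | h <;> omega
    · rw [Finset.card_eq_zero, Finset.filter_eq_empty_iff]
      intro p hp hj
      have hp := (Finset.mem_filter.1 hp).2
      rcases hper p hp with h | h <;> omega
  rw [hmain]
  congr 1 <;> split_ifs <;> omega

end IsFiberMonotone

/-! ### Orbits of a permutation, their loads and their cycle monomials. -/

section Orbits

variable {E : Type*}

/-- The cycles of a permutation, including the trivial ones. -/
abbrev PermOrbit (S : Equiv.Perm E) : Type _ := Quotient (Equiv.Perm.SameCycle.setoid S)

namespace PermOrbit

variable {S : Equiv.Perm E}

/-- The orbit of an element. -/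
abbrev mk (S : Equiv.Perm E) (e : E) : PermOrbit S := Quotient.mk _ e

theorem mk_eq_iff {e e' : E} : mk S e = mk S e' ↔ S.SameCycle e e' := Quotient.eq

theorem mk_apply (e : E) : mk S (S e) = mk S e :=
  mk_eq_iff.2 (Equiv.Perm.sameCycle_apply_left.2 (Equiv.Perm.SameCycle.refl _ _))

theorem injOn_pow (e : E) :
    Set.InjOn (fun l => (S ^ l) e) (Finset.range (minimalPeriod S e) : Set ℕ) := by
  intro k hk l hl h
  simp only [← Equiv.Perm.iterate_eq_pow] at h
  exact (Function.iterate_eq_iterate_iff_of_lt_minimalPeriod (by simpa using hk)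
    (by simpa using hl)).1 h

variable [Fintype E]

noncomputable instance : Fintype (PermOrbit S) := Fintype.ofFinite _

noncomputable instance : DecidableEq (PermOrbit S) := Classical.decEq _

/-- The elements of an orbit. -/
noncomputable def elems (O : PermOrbit S) : Finset E := Finset.univ.filter fun e => mk S e = O

/-- The length of an orbit. -/
noncomputable def size (O : PermOrbit S) : ℕ := O.elems.card

/-- The product of the signs of the elements of an orbit. -/
noncomputable def sign (s : E → ℤ) (O : PermOrbit S) : ℤ := ∏ e ∈ O.elems, s e

theorem mem_elems {O : PermOrbit S} {e : E} : e ∈ O.elems ↔ mk S e = O := by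
  simp [elems]

theorem elems_mk [DecidableEq E] (e : E) :
    (mk S e).elems = (Finset.range (minimalPeriod S e)).image fun l => (S ^ l) e := by
  ext e'
  rw [mem_elems, mk_eq_iff, Finset.mem_image]
  constructor
  · intro h
    obtain ⟨k, -, hk⟩ := h.symm.exists_pow_eq'
    refine ⟨k % minimalPeriod S e, Finset.mem_range.2 (Nat.mod_lt _ (S.minimalPeriod_pos e)), ?_⟩
    rw [← hk, ← Equiv.Perm.iterate_eq_pow, ← Equiv.Perm.iterate_eq_pow,
      Function.iterate_mod_minimalPeriod_eq]
  · rintro ⟨k, -, rfl⟩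
    exact Equiv.Perm.SameCycle.symm ⟨k, by simp⟩

theorem size_mk (e : E) : (mk S e).size = minimalPeriod S e := by
  classical
  rw [size, elems_mk, Finset.card_image_of_injOn (injOn_pow e), Finset.card_range]

theorem sign_mk (s : E → ℤ) (e : E) :
    (mk S e).sign s = ∏ l ∈ Finset.range (minimalPeriod S e), s ((S ^ l) e) := by
  classical
  rw [sign, elems_mk, Finset.prod_image (injOn_pow e)]

theorem size_pos (O : PermOrbit S) : 0 < O.size := by
  induction O using Quotient.inductionOn with
  | h e => exact (size_mk e).symm ▸ S.minimalPeriod_pos e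

theorem eq_of_mk_eq {β : Type*} {ρ : E → β} (h : ∀ e, ρ (S e) = ρ e) {e e' : E}
    (he : mk S e = mk S e') : ρ e = ρ e' := by
  obtain ⟨k, -, rfl⟩ := (mk_eq_iff.1 he).exists_pow_eq'
  induction k with
  | zero => simp
  | succ k ih =>
    rw [pow_succ', Equiv.Perm.mul_apply, h]
    exact ih (mk_eq_iff.2 ⟨k, by simp⟩)

theorem sum_eq_sum_sum_elems {β : Type*} [AddCommMonoid β] (f : E → β) :
    ∑ e, f e = ∑ O : PermOrbit S, ∑ e ∈ O.elems, f e :=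
  (Finset.sum_fiberwise_of_maps_to (fun _ _ => Finset.mem_univ _) f).symm

variable {n : ℕ}

/-- The number of positions that are mapped to the orbit `O`. -/
noncomputable def load (π : Fin n → E) (O : PermOrbit S) : ℕ :=
  (Finset.univ.filter fun p => mk S (π p) = O).card

theorem sum_load (π : Fin n → E) : ∑ O : PermOrbit S, load π O = n := by
  simp only [load]
  rw [← Finset.card_eq_sum_card_fiberwise (fun _ _ => Finset.mem_coe.2 (Finset.mem_univ _))]
  simp

/-- Invariance makes fiber sizes constant along an orbit, so `load / size` is the multiplicity of
the orbit in the multiset. -/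
theorem load_mk [DecidableEq E] {π : Fin n → E}
    (h : ∀ e, (Finset.univ.filter fun p => π p = S e).card =
      (Finset.univ.filter fun p => π p = e).card) (e : E) :
    load π (mk S e) = (mk S e).size * (Finset.univ.filter fun p => π p = e).card := by
  rw [load, Finset.card_eq_sum_card_fiberwise (f := π) (t := (mk S e).elems)]
  · rw [Finset.sum_congr rfl (g := fun _ => (Finset.univ.filter fun p => π p = e).card),
      Finset.sum_const, smul_eq_mul, size]
    intro e' he'
    rw [mem_elems] at he'
    rw [← eq_of_mk_eq (ρ := fun e => (Finset.univ.filter fun p => π p = e).card) h he',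
      Finset.filter_filter]
    congr 1
    refine Finset.filter_congr fun p _ => ⟨fun h => h.2, fun h => ⟨?_, h⟩⟩
    rw [h, he']
  · intro p hp
    have hp : mk S (π p) = mk S e := by simpa using hp
    exact mem_elems.2 hp

/-- The cycle monomial of `r` points over each element of an orbit. -/
noncomputable def cycleMonomial (s : E → ℤ) (O : PermOrbit S) (r : ℕ) : MvPolynomial ℕ ℚ :=
  if O.sign s = 1 then MvPolynomial.X O.size ^ r
  else MvPolynomial.X O.size ^ (r % 2) * MvPolynomial.X (2 * O.size) ^ (r / 2)

/-- The number of `j`-cycles over an orbit when there are `r` points over each of its elements. -/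
noncomputable def cycleCount (s : E → ℤ) (O : PermOrbit S) (r j : ℕ) : ℕ :=
  if O.sign s = 1 then (if j = O.size then r else 0)
  else (if j = O.size then r % 2 else 0) + if j = 2 * O.size then r / 2 else 0

theorem prod_X_pow_cycleCount (s : E → ℤ) (O : PermOrbit S) (r K : ℕ) (hK : 2 * O.size ≤ K) :
    ∏ j ∈ Finset.Icc 1 K, (MvPolynomial.X j : MvPolynomial ℕ ℚ) ^ O.cycleCount s r j =
      O.cycleMonomial s r := by
  have hpos := O.size_pos
  have key : ∀ i b : ℕ, 1 ≤ i → i ≤ K →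
      ∏ j ∈ Finset.Icc 1 K, (MvPolynomial.X j : MvPolynomial ℕ ℚ) ^ (if j = i then b else 0) =
        MvPolynomial.X i ^ b := by
    intro i b h1 h2
    rw [Finset.prod_eq_single i]
    · rw [if_pos rfl]
    · intro j _ hj
      rw [if_neg hj, pow_zero]
    · intro h
      exact absurd (Finset.mem_Icc.2 ⟨h1, h2⟩) h
  rw [cycleMonomial]
  split_ifs with h
  · simp only [cycleCount, if_pos h]
    exact key _ _ (by omega) (by omega)
  · simp only [cycleCount, if_neg h, pow_add, Finset.prod_mul_distrib]
    rw [key _ _ (by omega) (by omega), key _ _ (by omega) (by omega)]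

theorem _root_.IsFiberMonotone.numCycles_eq [DecidableEq E] {w : Equiv.Perm (Fin n)}
    {π : Fin n → E} {s : E → ℤ} (H : IsFiberMonotone w S π s)
    (h : ∀ e, (Finset.univ.filter fun p => π p = S e).card =
      (Finset.univ.filter fun p => π p = e).card) {j : ℕ} (hj : 1 ≤ j) :
    numCycles j w = ∑ O : PermOrbit S, O.cycleCount s (load π O / O.size) j := by
  refine Nat.eq_of_mul_eq_mul_left hj ?_
  rw [numCycles_mul w hj, Finset.card_eq_sum_card_fiberwise (f := π) (t := Finset.univ)
    (fun _ _ => Finset.mem_coe.2 (Finset.mem_univ _)), sum_eq_sum_sum_elems (S := S),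
    Finset.mul_sum]
  refine Finset.sum_congr rfl fun O _ => ?_
  have key : ∀ e ∈ O.elems,
      ((Finset.univ.filter fun p => minimalPeriod w p = j).filter fun p => π p = e).card =
      if O.sign s = 1 then (if j = O.size then load π O / O.size else 0)
      else (if j = O.size then (load π O / O.size) % 2 else 0) +
        if j = 2 * O.size then 2 * ((load π O / O.size) / 2) else 0 := by
    intro e he
    rw [mem_elems] at he
    subst he
    have hload : load π (mk S e) / (mk S e).size =
        (Finset.univ.filter fun p => π p = e).card := by
      rw [load_mk h, Nat.mul_div_cancel_left _ (size_pos _)]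
    rw [hload, Finset.filter_filter, sign_mk, size_mk]
    simp only [and_comm]
    by_cases hs : ∏ l ∈ Finset.range (minimalPeriod S e), s ((S ^ l) e) = 1
    · rw [H.card_filter_of_one e j hs, if_pos hs]
    · rw [H.card_filter_of_neg_one e j ((H.prod_sign e _).resolve_left hs), if_neg hs]
  rw [Finset.sum_congr rfl key, Finset.sum_const, smul_eq_mul, ← size, cycleCount]
  have := O.size_pos
  split_ifs with h1 h2 h2 h3 h3
  · rw [h2]
  · rfl
  · omega
  · rw [h2]
  · rw [h3]; ring
  · rfl

theorem _root_.IsFiberMonotone.prod_X_pow_numCycles [DecidableEq E] {w : Equiv.Perm (Fin n)}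
    {π : Fin n → E} {s : E → ℤ} (H : IsFiberMonotone w S π s)
    (h : ∀ e, (Finset.univ.filter fun p => π p = S e).card =
      (Finset.univ.filter fun p => π p = e).card) :
    ∏ i ∈ Finset.Icc 1 n, (MvPolynomial.X i : MvPolynomial ℕ ℚ) ^ numCycles i w =
      ∏ O : PermOrbit S, O.cycleMonomial s (load π O / O.size) := by
  -- The factors of a single orbit involve indices up to twice its size, possibly beyond `n`.
  -- Enlarging the range costs nothing, since there are no cycles longer than `n`, and lets the
  -- product be evaluated orbit by orbit.
  set K := n + 2 * Fintype.card E with hK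
  have hext : ∏ i ∈ Finset.Icc 1 n, (MvPolynomial.X i : MvPolynomial ℕ ℚ) ^ numCycles i w =
      ∏ i ∈ Finset.Icc 1 K, (MvPolynomial.X i : MvPolynomial ℕ ℚ) ^ numCycles i w := by
    refine Finset.prod_subset (Finset.Icc_subset_Icc_right (by omega)) fun i hi hi' => ?_
    rw [Finset.mem_Icc] at hi hi'
    have h0 : numCycles i w = 0 := by
      have hle : i * numCycles i w ≤ n := by
        rw [numCycles_mul w hi.1]
        exact (Finset.card_le_univ _).trans (by simp)
      by_contra hne
      have : i * 1 ≤ i * numCycles i w := Nat.mul_le_mul_left _ (by omega)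
      omega
    rw [h0, pow_zero]
  rw [hext, Finset.prod_congr rfl fun i hi => by
    rw [H.numCycles_eq h (Finset.mem_Icc.1 hi).1, ← Finset.prod_pow_eq_pow_sum],
    Finset.prod_comm]
  refine Finset.prod_congr rfl fun O _ => prod_X_pow_cycleCount s O _ K ?_
  have : O.size ≤ Fintype.card E := Finset.card_le_univ _
  omega

end PermOrbit

end Orbits

/-! ### Words of length `n` as multisets of shift orbits. -/

section Words

variable {m n N : ℕ} [NeZero N]

/-- The sign of the first letter of a periodic word. -/
def firstSign (e : PeriodicWord m N) : ℤ := letterSign (letter e)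

theorem isFiberMonotone_itinerary (hN : n.factorial ∣ N) (c : Fin n → Fin (2 * m)) :
    IsFiberMonotone (shelfPerm c) shift (itinerary N c) firstSign where
  map_apply := itinerary_shelfPerm hN c
  sign e := letterSign_eq_or _
  lt_of_one p q h he hs := by
    rw [firstSign, letter_itinerary hN] at hs
    refine shelfPerm_lt_of_even c h ?_ hs
    rw [← letter_itinerary hN c p, he, letter_itinerary hN]
  lt_of_neg_one p q h he hs := by
    rw [firstSign, letter_itinerary hN] at hs
    refine shelfPerm_lt_of_odd c h ?_ hs
    rw [← letter_itinerary hN c p, he, letter_itinerary hN]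

/-- Loads give the fiber sizes of the itinerary; these determine it by monotonicity, and it
determines the labels. -/
theorem load_itinerary_injective (hN : n.factorial ∣ N) {c c' : Fin n → Fin (2 * m)}
    (h : ∀ O : PermOrbit (shift (m := m) (N := N)),
      PermOrbit.load (itinerary N c) O = PermOrbit.load (itinerary N c') O) : c = c' := by
  refine itinerary_injective hN ((itinerary_mono hN c).eq_of_card_fiber_eq
    (itinerary_mono hN c') fun e => ?_)
  have := h (PermOrbit.mk _ e)
  have h1 := PermOrbit.load_mk (card_itinerary_shift hN c) e
  have h2 := PermOrbit.load_mk (card_itinerary_shift hN c') e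
  refine Nat.eq_of_mul_eq_mul_left (PermOrbit.size_pos (PermOrbit.mk shift e)) ?_
  convert (h1.symm.trans this).trans h2

theorem exists_monotone_card_fiber {α : Type*} [LinearOrder α] [Fintype α] (ρ : α → ℕ)
    (h : ∑ a, ρ a = n) : ∃ π : Fin n → α, Monotone π ∧
      ∀ a, (Finset.univ.filter fun p => π p = a).card = ρ a := by
  have hcard : Fintype.card (Σ a : α, Fin (ρ a)) = Fintype.card (Fin n) := by simp [h]
  set f : Fin n → α := fun p => ((Fintype.equivOfCardEq hcard).symm p).1 with hf
  refine ⟨f ∘ Tuple.sort f, Tuple.monotone_sort f, fun a => ?_⟩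
  have hb : (Finset.univ.filter fun p => (f ∘ Tuple.sort f) p = a).card =
      (Finset.univ.filter fun x : Σ a : α, Fin (ρ a) => x.1 = a).card := by
    refine Finset.card_equiv ((Tuple.sort f).trans (Fintype.equivOfCardEq hcard).symm) ?_
    intro p
    simp [hf]
  rw [hb]
  have : (Finset.univ.filter fun x : Σ a : α, Fin (ρ a) => x.1 = a) =
      Finset.univ.map (Function.Embedding.sigmaMk a) := by
    ext ⟨b, x⟩
    simp only [Finset.mem_filter, Finset.mem_univ, true_and, Finset.mem_map,
      Function.Embedding.sigmaMk_apply]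
    constructor
    · rintro rfl
      exact ⟨x, rfl⟩
    · rintro ⟨y, hy⟩
      exact (congrArg Sigma.fst hy).symm
  rw [this, Finset.card_map, Finset.card_univ, Fintype.card_fin]

/-- Give each word the multiplicity of its orbit and list the words in increasing order; this
monotone map has shift-invariant fiber sizes and so is an itinerary. -/
theorem exists_load_itinerary (hN : n.factorial ∣ N)
    (l : PermOrbit (shift (m := m) (N := N)) → ℕ) (hl : ∑ O, l O = n)
    (hd : ∀ O, O.size ∣ l O) :
    ∃ c : Fin n → Fin (2 * m), ∀ O, PermOrbit.load (itinerary N c) O = l O := by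
  obtain ⟨π, hπ, hcard⟩ := exists_monotone_card_fiber (n := n)
    (fun e : PeriodicWord m N => l (PermOrbit.mk shift e) / (PermOrbit.mk shift e).size) (by
      rw [PermOrbit.sum_eq_sum_sum_elems (S := shift), ← hl]
      refine Finset.sum_congr rfl fun O _ => ?_
      rw [Finset.sum_congr rfl (g := fun _ => l O / O.size), Finset.sum_const, smul_eq_mul]
      · exact Nat.mul_div_cancel' (hd O)
      · intro e he
        rw [PermOrbit.mem_elems.1 he])
  have hinv : ∀ e, (Finset.univ.filter fun p => π p = shift e).card =
      (Finset.univ.filter fun p => π p = e).card := by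
    intro e
    rw [hcard, hcard, PermOrbit.mk_apply]
  refine ⟨fun p => letter (shift.symm (π p)), fun O => ?_⟩
  rw [itinerary_letter_symm_shift hN hπ hinv]
  induction O using Quotient.inductionOn with
  | h e =>
    have h1 := PermOrbit.load_mk hinv e
    rw [hcard, Nat.mul_div_cancel' (hd _)] at h1
    exact h1

/-- Words of length `n` correspond to multisets of orbits of total length `n`. -/
theorem sum_prod_load (hN : n.factorial ∣ N)
    (h : PermOrbit (shift (m := m) (N := N)) → ℕ → MvPolynomial ℕ ℚ) :
    ∑ c : Fin n → Fin (2 * m), ∏ O, h O (PermOrbit.load (itinerary N c) O / O.size) =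
      ∑ l ∈ (Finset.univ : Finset (PermOrbit (shift (m := m) (N := N)))).finsuppAntidiag n,
        ∏ O, if O.size ∣ l O then h O (l O / O.size) else 0 := by
  have hdvd : ∀ (c : Fin n → Fin (2 * m)) (O : PermOrbit (shift (m := m) (N := N))),
      O.size ∣ PermOrbit.load (itinerary N c) O := by
    intro c O
    induction O using Quotient.inductionOn with
    | h e => exact ⟨_, PermOrbit.load_mk (card_itinerary_shift hN c) e⟩
  symm
  rw [← Finset.sum_filter_of_ne (p := fun l : PermOrbit (shift (m := m) (N := N)) →₀ ℕ =>
    ∀ O : PermOrbit (shift (m := m) (N := N)), O.size ∣ l O)]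
  symm
  · refine Finset.sum_bij
      (fun c _ => Finsupp.equivFunOnFinite.symm (PermOrbit.load (itinerary N c))) ?_ ?_ ?_ ?_
    · intro c _
      rw [Finset.mem_filter, Finset.mem_finsuppAntidiag]
      exact ⟨⟨PermOrbit.sum_load _, Finset.subset_univ _⟩, hdvd c⟩
    · intro c _ c' _ hcc
      exact load_itinerary_injective hN fun O => DFunLike.congr_fun hcc O
    · intro l hl
      rw [Finset.mem_filter, Finset.mem_finsuppAntidiag] at hl
      obtain ⟨c, hc⟩ := exists_load_itinerary hN l hl.1.1 hl.2
      exact ⟨c, Finset.mem_univ _, Finsupp.ext hc⟩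
    · intro c _
      refine Finset.prod_congr rfl fun O _ => ?_
      rw [Finsupp.equivFunOnFinite_symm_apply_apply, if_pos (hdvd c O)]
  · intro l _ hne O
    by_contra hO
    exact hne (Finset.prod_eq_zero (Finset.mem_univ O) (if_neg hO))

theorem sum_prod_X_pow_numCycles (hN : n.factorial ∣ N) :
    ∑ c : Fin n → Fin (2 * m), ∏ i ∈ Finset.Icc 1 n,
        (MvPolynomial.X i : MvPolynomial ℕ ℚ) ^ numCycles i (shelfPerm c) =
      ∑ l ∈ (Finset.univ : Finset (PermOrbit (shift (m := m) (N := N)))).finsuppAntidiag n,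
        ∏ O, if O.size ∣ l O then O.cycleMonomial firstSign (l O / O.size) else 0 := by
  rw [← sum_prod_load hN fun O r => O.cycleMonomial firstSign r]
  refine Finset.sum_congr rfl fun c _ => ?_
  exact (isFiberMonotone_itinerary hN c).prod_X_pow_numCycles (card_itinerary_shift hN c)

end Words

/-! ### Möbius inversion over odd divisors. -/

section OddDivisors

theorem Nat.sum_filter_odd_div_divisors {M : Type*} [AddCommMonoid M] (j : ℕ) (f : ℕ → M) :
    ∑ d ∈ j.divisors.filter (fun d => Odd d), f (j / d) =
      ∑ i ∈ j.divisors.filter (fun i => Odd (j / i)), f i := by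
  rw [Finset.sum_filter, Finset.sum_filter,
    ← Nat.sum_div_divisors j (fun i => if Odd (j / i) then f i else 0)]
  refine Finset.sum_congr rfl fun d hd => ?_
  have hd := Nat.mem_divisors.1 hd
  rw [Nat.div_div_self hd.1 hd.2]

theorem Nat.filter_odd_divisors_two_pow_mul {t : ℕ} (ht : Odd t) (s : ℕ) :
    (2 ^ s * t).divisors.filter (fun d => Odd d) = t.divisors := by
  have ht0 : t ≠ 0 := by rintro rfl; simp at ht
  ext d
  rw [Finset.mem_filter, Nat.mem_divisors, Nat.mem_divisors]
  constructor
  · rintro ⟨⟨h, -⟩, hd⟩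
    exact ⟨(Nat.Coprime.pow_right s (Nat.coprime_two_right.2 hd)).dvd_of_dvd_mul_left h, ht0⟩
  · rintro ⟨h, -⟩
    exact ⟨⟨h.mul_left _, by positivity⟩, ht.of_dvd_nat h⟩

/-- Möbius inversion over odd divisors. -/
theorem eq_sum_moebius_of_sum_odd_divisors {R : Type*} [Ring R] {N : ℕ} (a B : ℕ → R)
    (h : ∀ j, j ≠ 0 → j ∣ N → ∑ d ∈ j.divisors.filter (fun d => Odd d), a (j / d) = B j)
    {i : ℕ} (hi : i ≠ 0) (hiN : i ∣ N) :
    a i = ∑ d ∈ i.divisors.filter (fun d => Odd d),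
      (ArithmeticFunction.moebius d : R) * B (i / d) := by
  obtain ⟨s, t, ht, rfl⟩ := Nat.exists_eq_two_pow_mul_odd hi
  have ht0 : 0 < t := ht.pos
  -- With `i = 2^s t` and `t` odd, the odd divisors of `i` are all the divisors of `t`, so ordinary
  -- inversion applies in the variable `x` of `2^s x`.
  have key := (ArithmeticFunction.sum_eq_iff_sum_mul_moebius_eq_on (R := R)
    (f := fun x => a (2 ^ s * x)) (g := fun x => B (2 ^ s * x)) {x | x ∣ t}
    (fun x y hxy hy => hxy.trans hy)).1 ?_ t ht0 dvd_rfl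
  · rw [Nat.filter_odd_divisors_two_pow_mul ht, ← key,
      Nat.sum_divisorsAntidiagonal
        (f := fun x y => (ArithmeticFunction.moebius x : R) * B (2 ^ s * y))]
    refine Finset.sum_congr rfl fun d hd => ?_
    rw [Nat.mul_div_assoc _ (Nat.mem_divisors.1 hd).1]
  · intro x hx hxt
    have hxo : Odd x := ht.of_dvd_nat hxt
    have := h (2 ^ s * x) (by positivity) ((Nat.mul_dvd_mul_left _ hxt).trans hiN)
    rw [Nat.filter_odd_divisors_two_pow_mul hxo] at this
    rw [← this, ← Nat.sum_div_divisors]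
    refine Finset.sum_congr rfl fun d hd => ?_
    rw [Nat.mul_div_assoc _ (Nat.mem_divisors.1 hd).1]

theorem Nat.sum_filter_not_odd_divisors {M : Type*} [AddCommMonoid M] {k : ℕ} (hk : k ≠ 0)
    (f : ℕ → M) :
    ∑ i ∈ (2 * k).divisors.filter (fun i => ¬ Odd (2 * k / i)), f i = ∑ i ∈ k.divisors, f i := by
  refine Finset.sum_congr ?_ fun _ _ => rfl
  ext i
  rw [Finset.mem_filter, Nat.mem_divisors, Nat.mem_divisors, Nat.not_odd_iff_even]
  constructor
  · rintro ⟨⟨⟨c, hc⟩, -⟩, h⟩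
    have hi : 0 < i := by
      rcases Nat.eq_zero_or_pos i with rfl | hi
      · omega
      · exact hi
    rw [hc, Nat.mul_div_cancel_left _ hi] at h
    obtain ⟨b, rfl⟩ := h
    exact ⟨⟨b, by linarith [mul_add i b b]⟩, hk⟩
  · rintro ⟨⟨c, rfl⟩, -⟩
    have hi : 0 < i := Nat.pos_of_ne_zero (left_ne_zero_of_mul hk)
    refine ⟨⟨⟨2 * c, by ring⟩, by omega⟩, ?_⟩
    rw [show 2 * (i * c) = i * (2 * c) by ring, Nat.mul_div_cancel_left _ hi]
    exact even_two_mul c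

theorem Nat.sum_filter_odd_divisors_two_mul {M : Type*} [AddCommMonoid M] {k : ℕ} (hk : k ≠ 0)
    (f : ℕ → M) :
    ∑ i ∈ (2 * k).divisors.filter (fun i => Odd (2 * k / i)),
      (if Even i then f (i / 2) else 0) =
    ∑ i ∈ k.divisors.filter (fun i => Odd (k / i)), f i := by
  symm
  refine Finset.sum_bij_ne_zero (fun i _ _ => 2 * i) ?_ ?_ ?_ ?_
  · intro i hi _
    rw [Finset.mem_filter, Nat.mem_divisors] at hi ⊢
    rw [Nat.mul_div_mul_left _ _ two_pos]
    exact ⟨⟨Nat.mul_dvd_mul_left _ hi.1.1, by omega⟩, hi.2⟩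
  · intro i _ _ j _ _ h
    exact Nat.eq_of_mul_eq_mul_left two_pos h
  · intro i hi hne
    have hev : Even i := by
      by_contra h
      rw [if_neg h] at hne
      exact hne rfl
    rw [if_pos hev] at hne
    obtain ⟨c, rfl⟩ := even_iff_two_dvd.1 hev
    rw [Nat.mul_div_cancel_left _ two_pos] at hne
    rw [Finset.mem_filter, Nat.mem_divisors, Nat.mul_div_mul_left _ _ two_pos] at hi
    refine ⟨c, ?_, hne, rfl⟩
    rw [Finset.mem_filter, Nat.mem_divisors]
    exact ⟨⟨Nat.dvd_of_mul_dvd_mul_left two_pos hi.1.1, hk⟩, hi.2⟩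
  · intro i _ _
    rw [if_pos (even_two_mul i), Nat.mul_div_cancel_left _ two_pos]

/-- If a signed count over divisors vanishes, then the positive objects of size `i` and the
negative ones of size `i / 2` together are as many as the negative ones of size `i`. -/
theorem add_half_eq_of_signed_sum_eq_zero {N : ℕ} (P Q : ℕ → ℤ)
    (h : ∀ j, j ≠ 0 → j ∣ N →
      ∑ i ∈ j.divisors, (i : ℤ) * (P i + (-1) ^ (j / i) * Q i) = 0)
    {i : ℕ} (hi : i ≠ 0) (hiN : i ∣ N) :
    P i + (if Even i then Q (i / 2) else 0) = Q i := by
  have hsplit : ∀ j, j ≠ 0 → j ∣ N → ∑ i ∈ j.divisors, (i : ℤ) * P i =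
      ∑ i ∈ j.divisors.filter (fun i => Odd (j / i)), (i : ℤ) * Q i -
        ∑ i ∈ j.divisors.filter (fun i => ¬ Odd (j / i)), (i : ℤ) * Q i := by
    intro j hj hjN
    have h0 := h j hj hjN
    simp only [mul_add, Finset.sum_add_distrib] at h0
    rw [← Finset.sum_filter_add_sum_filter_not _ (fun i => Odd (j / i))
      (fun i => (i : ℤ) * ((-1) ^ (j / i) * Q i))] at h0
    rw [Finset.sum_congr (s₁ := j.divisors.filter (fun i => Odd (j / i))) rfl
        (g := fun i => -((i : ℤ) * Q i)), Finset.sum_neg_distrib,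
      Finset.sum_congr (s₁ := j.divisors.filter (fun i => ¬ Odd (j / i))) rfl
        (g := fun i => (i : ℤ) * Q i)] at h0
    · linarith
    · intro x hx
      rw [(Nat.not_odd_iff_even.1 (Finset.mem_filter.1 hx).2).neg_one_pow, one_mul]
    · intro x hx
      rw [(Finset.mem_filter.1 hx).2.neg_one_pow]
      ring
  -- `V i` is `i` times the defect of the claimed identity. Its sums over odd divisors vanish, so
  -- inversion gives `V i = 0`. The middle term is written as `2 * (i / 2)` to match sums over the
  -- divisors of `j / 2`.
  set V : ℕ → ℤ := fun i =>
    (i : ℤ) * P i + (if Even i then 2 * (((i / 2 : ℕ) : ℤ) * Q (i / 2)) else 0) - (i : ℤ) * Q i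
    with hV
  have hsum : ∀ j, j ≠ 0 → j ∣ N →
      ∑ d ∈ j.divisors.filter (fun d => Odd d), V (j / d) = (fun _ => (0 : ℤ)) j := by
    intro j hj hjN
    rw [Nat.sum_filter_odd_div_divisors]
    simp only [hV, Finset.sum_sub_distrib, Finset.sum_add_distrib]
    have h1 := hsplit j hj hjN
    rw [← Finset.sum_filter_add_sum_filter_not _ (fun i => Odd (j / i))] at h1
    rcases Nat.even_or_odd' j with ⟨k, rfl | rfl⟩
    · have hk : k ≠ 0 := by omega
      -- For `j = 2k`, the divisors with even quotient are the divisors of `k`. Substituting the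
      -- relation at `k` cancels its even-quotient part and doubles its odd-quotient part.
      have h2 := hsplit k hk ((Nat.dvd_mul_left k 2).trans hjN)
      rw [Nat.sum_filter_not_odd_divisors hk, Nat.sum_filter_not_odd_divisors hk, h2,
        ← Finset.sum_filter_add_sum_filter_not k.divisors (fun i => Odd (k / i))
          (fun i => (i : ℤ) * Q i)] at h1
      rw [Nat.sum_filter_odd_divisors_two_mul hk (fun i => 2 * ((i : ℤ) * Q i)),
        ← Finset.mul_sum]
      linarith
    · have hempty : (2 * k + 1).divisors.filter (fun i => ¬ Odd ((2 * k + 1) / i)) = ∅ := by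
        rw [Finset.filter_eq_empty_iff]
        intro i hi
        rw [not_not]
        exact Odd.of_dvd_nat (odd_two_mul_add_one k) (Nat.div_dvd_of_dvd (Nat.mem_divisors.1 hi).1)
      have hz : ∑ i ∈ (2 * k + 1).divisors.filter (fun i => Odd ((2 * k + 1) / i)),
          (if Even i then 2 * (((i / 2 : ℕ) : ℤ) * Q (i / 2)) else 0) = 0 := by
        refine Finset.sum_eq_zero fun i hi => if_neg ?_
        rw [Nat.not_even_iff_odd]
        exact Odd.of_dvd_nat (odd_two_mul_add_one k)
          (Nat.mem_divisors.1 (Finset.mem_filter.1 hi).1).1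
      rw [hempty, Finset.sum_empty, Finset.sum_empty] at h1
      rw [hz]
      linarith
  have hVi : V i = 0 := by
    rw [eq_sum_moebius_of_sum_odd_divisors V (fun _ => 0) hsum hi hiN]
    simp
  have hi' : (i : ℤ) ≠ 0 := by exact_mod_cast hi
  refine mul_left_cancel₀ hi' ?_
  rw [hV] at hVi
  dsimp only at hVi
  split_ifs at hVi ⊢ with hev
  · have h2 : (i : ℤ) = 2 * ((i / 2 : ℕ) : ℤ) := by
      exact_mod_cast (Nat.mul_div_cancel' (even_iff_two_dvd.1 hev)).symm
    rw [mul_add]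
    nth_rewrite 2 [h2]
    linarith
  · linarith

end OddDivisors

/-! ### Counting positive and negative orbits. -/

section OrbitCount

theorem firstSign_eq_or {m N : ℕ} (e : PeriodicWord m N) : firstSign e = 1 ∨ firstSign e = -1 :=
  letterSign_eq_or _

variable {m N : ℕ} [NeZero N]

/-- As `j ∣ N`, the words fixed by `shift ^ j` are the periodic extensions of arbitrary `j`-tuples,
and the sum is the expanded power. -/
theorem sum_prod_letter_shift_pow {R : Type*} [CommRing R] (g : Fin (2 * m) → R) {j : ℕ}
    (hj : j ≠ 0) (hjN : j ∣ N) :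
    ∑ e ∈ Finset.univ.filter (fun e : PeriodicWord m N => (shift ^ j) e = e),
      ∏ l ∈ Finset.range j, g (letter ((shift ^ l) e)) = (∑ a, g a) ^ j := by
  have hj0 : 0 < j := Nat.pos_of_ne_zero hj
  have hval : ∀ l : ℕ, (l : ZMod N).val % j = l % j := fun l => by
    rw [ZMod.val_natCast, Nat.mod_mod_of_dvd _ hjN]
  let W : (Fin j → Fin (2 * m)) → PeriodicWord m N :=
    fun f k => f ⟨k.val % j, Nat.mod_lt _ hj0⟩
  have hW : ∀ (f : Fin j → Fin (2 * m)) (l : ℕ),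
      W f (l : ZMod N) = f ⟨l % j, Nat.mod_lt _ hj0⟩ := fun f l => by
    simp only [W, hval]
  rw [Fintype.sum_pow]
  symm
  refine Finset.sum_bij (fun f _ => W f) ?_ ?_ ?_ ?_
  · intro f _
    rw [Finset.mem_filter]
    refine ⟨Finset.mem_univ _, ?_⟩
    funext k
    rw [shift_pow_apply]
    obtain ⟨l, rfl⟩ : ∃ l : ℕ, (l : ZMod N) = k := ⟨k.val, ZMod.natCast_zmod_val k⟩
    rw [← Nat.cast_add, hW, hW]
    simp
  · intro f _ f' _ h
    funext x
    have h1 := congrFun h ((x : ℕ) : ZMod N)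
    rw [hW, hW] at h1
    simpa [Nat.mod_eq_of_lt x.2] using h1
  · intro e he
    have he := (Finset.mem_filter.1 he).2
    have hper : ∀ (q a : ℕ), e ((a + j * q : ℕ) : ZMod N) = e (a : ZMod N) := by
      intro q a
      induction q with
      | zero => simp
      | succ q ih =>
        have := congrFun he ((a + j * q : ℕ) : ZMod N)
        rw [shift_pow_apply, ih, ← Nat.cast_add] at this
        rw [← this, mul_add, mul_one, add_assoc]
    let f : Fin j → Fin (2 * m) := fun x => e ((x : ℕ) : ZMod N)
    refine ⟨f, Finset.mem_univ _, ?_⟩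
    funext k
    obtain ⟨l, rfl⟩ : ∃ l : ℕ, (l : ZMod N) = k := ⟨k.val, ZMod.natCast_zmod_val k⟩
    refine (hW f l).trans ?_
    have := hper (l / j) (l % j)
    rw [Nat.mod_add_div] at this
    exact this.symm
  · intro f _
    rw [← Fin.prod_univ_eq_prod_range (fun l => g (letter ((shift ^ l) (W f))))]
    refine Finset.prod_congr rfl fun x _ => ?_
    rw [letter_shift_pow, hW]
    simp [Nat.mod_eq_of_lt x.2]

namespace PermOrbit

theorem prod_range_sign {E : Type*} [Fintype E] {S : Equiv.Perm E} (s : E → ℤ) (e : E) {j : ℕ}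
    (hj : (mk S e).size ∣ j) :
    ∏ l ∈ Finset.range j, s ((S ^ l) e) = (mk S e).sign s ^ (j / (mk S e).size) := by
  obtain ⟨k, rfl⟩ := hj
  rw [Nat.mul_div_cancel_left _ (size_pos _), sign_mk, size_mk]
  induction k with
  | zero => simp
  | succ k ih =>
    rw [mul_add, mul_one, Finset.prod_range_add, ih, pow_succ]
    congr 1
    refine Finset.prod_congr rfl fun l _ => ?_
    rw [add_comm, pow_add, Equiv.Perm.mul_apply, ← Equiv.Perm.iterate_eq_pow S (_ * k),
      (Function.isPeriodicPt_minimalPeriod S e).mul_const k]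

theorem sum_filter_pow_eq {E : Type*} [Fintype E] [DecidableEq E] {S : Equiv.Perm E} {R : Type*}
    [CommRing R] (j : ℕ) (f : PermOrbit S → R) :
    ∑ e ∈ Finset.univ.filter (fun e : E => (S ^ j) e = e), f (mk S e) =
      ∑ O ∈ Finset.univ.filter (fun O : PermOrbit S => O.size ∣ j), (O.size : R) * f O := by
  rw [Finset.sum_filter, Finset.sum_filter, sum_eq_sum_sum_elems (S := S)]
  refine Finset.sum_congr rfl fun O _ => ?_
  rw [Finset.sum_congr rfl (g := fun _ => if O.size ∣ j then f O else 0), Finset.sum_const,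
    nsmul_eq_mul, mul_ite, mul_zero]
  · rfl
  · intro e he
    rw [mem_elems] at he
    subst he
    have : (S ^ j) e = e ↔ (mk S e).size ∣ j := by
      rw [size_mk, ← Equiv.Perm.isPeriodicPt_iff, Function.isPeriodicPt_iff_minimalPeriod_dvd]
    simp only [this]

theorem sign_eq_or {E : Type*} [Fintype E] {S : Equiv.Perm E} {s : E → ℤ}
    (hs : ∀ e, s e = 1 ∨ s e = -1) (O : PermOrbit S) : O.sign s = 1 ∨ O.sign s = -1 :=
  Finset.prod_induction s (fun x => x = 1 ∨ x = -1)
    (by rintro _ _ (rfl | rfl) (rfl | rfl) <;> simp) (Or.inl rfl) fun e _ => hs e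

end PermOrbit

/-- The orbits of length `i` with an even number of reversing letters. -/
noncomputable def posOrbits (m N i : ℕ) [NeZero N] :
    Finset (PermOrbit (shift (m := m) (N := N))) :=
  Finset.univ.filter fun O => O.sign firstSign = 1 ∧ O.size = i

/-- The orbits of length `i` with an odd number of reversing letters. -/
noncomputable def negOrbits (m N i : ℕ) [NeZero N] :
    Finset (PermOrbit (shift (m := m) (N := N))) :=
  Finset.univ.filter fun O => ¬ O.sign firstSign = 1 ∧ O.size = i

theorem sum_divisors_mul_card (f : ℤ → ℕ → ℤ) {j : ℕ} (hj : j ≠ 0) :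
    ∑ O ∈ Finset.univ.filter (fun O : PermOrbit (shift (m := m) (N := N)) => O.size ∣ j),
      (O.size : ℤ) * f (O.sign firstSign) O.size =
    ∑ i ∈ j.divisors, (i : ℤ) * ((posOrbits m N i).card * f 1 i +
      (negOrbits m N i).card * f (-1) i) := by
  rw [← Finset.sum_fiberwise_of_maps_to
    (s := Finset.univ.filter fun O : PermOrbit (shift (m := m) (N := N)) => O.size ∣ j)
    (t := j.divisors) (g := fun O => O.size)
    (fun O hO => Nat.mem_divisors.2 ⟨(Finset.mem_filter.1 hO).2, hj⟩)]
  refine Finset.sum_congr rfl fun i hi => ?_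
  rw [Finset.filter_filter, ← Finset.sum_filter_add_sum_filter_not _
    (fun O => O.sign firstSign = 1), Finset.filter_filter, Finset.filter_filter]
  have h1 : Finset.univ.filter (fun O : PermOrbit (shift (m := m) (N := N)) =>
      (O.size ∣ j ∧ O.size = i) ∧ O.sign firstSign = 1) = posOrbits m N i := by
    refine Finset.filter_congr fun O _ => ⟨fun h => ⟨h.2, h.1.2⟩, fun h => ⟨⟨?_, h.2⟩, h.1⟩⟩
    exact h.2 ▸ (Nat.mem_divisors.1 hi).1
  have h2 : Finset.univ.filter (fun O : PermOrbit (shift (m := m) (N := N)) =>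
      (O.size ∣ j ∧ O.size = i) ∧ ¬ O.sign firstSign = 1) = negOrbits m N i := by
    refine Finset.filter_congr fun O _ => ⟨fun h => ⟨h.2, h.1.2⟩, fun h => ⟨⟨?_, h.2⟩, h.1⟩⟩
    exact h.2 ▸ (Nat.mem_divisors.1 hi).1
  rw [h1, h2, Finset.sum_congr (s₁ := posOrbits m N i) rfl (g := fun _ => (i : ℤ) * f 1 i),
    Finset.sum_congr (s₁ := negOrbits m N i) rfl (g := fun _ => (i : ℤ) * f (-1) i),
    Finset.sum_const, Finset.sum_const, nsmul_eq_mul, nsmul_eq_mul]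
  · ring
  · intro O hO
    obtain ⟨h, h'⟩ := (Finset.mem_filter.1 hO).2
    rw [(PermOrbit.sign_eq_or firstSign_eq_or O).resolve_left h, h']
  · intro O hO
    obtain ⟨h, h'⟩ := (Finset.mem_filter.1 hO).2
    rw [h, h']

theorem sum_divisors_card_orbits {j : ℕ} (hj : j ≠ 0) (hjN : j ∣ N) :
    ∑ i ∈ j.divisors, (i : ℤ) * ((posOrbits m N i).card + (negOrbits m N i).card) =
      (2 * m : ℤ) ^ j := by
  have h := sum_prod_letter_shift_pow (m := m) (N := N) (fun _ => (1 : ℤ)) hj hjN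
  have h' := PermOrbit.sum_filter_pow_eq (S := shift (m := m) (N := N)) j (fun _ => (1 : ℤ))
  have h'' := sum_divisors_mul_card (m := m) (N := N) (fun _ _ => 1) hj
  simp only [mul_one] at h''
  simp only [Finset.prod_const_one] at h
  simp only [mul_one] at h'
  rw [← h'', ← h', h]
  simp

/-- There are as many keeping as reversing letters, so the signed count of fixed words is `0 ^ j`. A
window of length `j` runs `j / i` times through an orbit of length `i`, whence the power of the
sign. -/
theorem sum_divisors_signed_card_orbits {j : ℕ} (hj : j ≠ 0) (hjN : j ∣ N) :
    ∑ i ∈ j.divisors, (i : ℤ) * ((posOrbits m N i).card +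
      (-1) ^ (j / i) * (negOrbits m N i).card) = 0 := by
  have h := sum_prod_letter_shift_pow (m := m) (N := N) letterSign hj hjN
  have h' := PermOrbit.sum_filter_pow_eq (S := shift (m := m) (N := N)) j
    (fun O => O.sign firstSign ^ (j / O.size))
  have h'' := sum_divisors_mul_card (m := m) (N := N) (fun x i => x ^ (j / i)) hj
  simp only [one_pow, mul_one] at h''
  rw [sum_letterSign, zero_pow hj] at h
  rw [← h]
  simp only [mul_comm ((-1 : ℤ) ^ _)]
  rw [← h'', ← h']
  refine Finset.sum_congr rfl fun e he => ?_
  have he := (Finset.mem_filter.1 he).2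
  refine (PermOrbit.prod_range_sign firstSign e ?_).symm
  rw [PermOrbit.size_mk, ← Function.isPeriodicPt_iff_minimalPeriod_dvd,
    Equiv.Perm.isPeriodicPt_iff, he]

theorem card_negOrbits {i : ℕ} (hi : i ≠ 0) (hiN : i ∣ N) :
    ((negOrbits m N i).card : ℚ) = shelfExponent i m := by
  have key := eq_sum_moebius_of_sum_odd_divisors (N := N) (R := ℚ)
    (fun i => 2 * i * ((negOrbits m N i).card : ℚ)) (fun j => (2 * (m : ℚ)) ^ j) ?_ hi hiN
  · rw [shelfExponent, ← key]
    have : (i : ℚ) ≠ 0 := by exact_mod_cast hi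
    field_simp
  · intro j hj hjN
    rw [Nat.sum_filter_odd_div_divisors j (fun i => 2 * i * ((negOrbits m N i).card : ℚ))]
    have h1 := sum_divisors_card_orbits (m := m) hj hjN
    have h2 := sum_divisors_signed_card_orbits (m := m) hj hjN
    -- Subtracting the signed count from the plain one kills the positive orbits and the negative
    -- orbits with even quotient, and doubles the rest.
    have h3 : ∑ i ∈ j.divisors.filter (fun i => Odd (j / i)),
        2 * (i : ℤ) * ((negOrbits m N i).card : ℤ) = (2 * (m : ℤ)) ^ j := by
      rw [← sub_zero ((2 * (m : ℤ)) ^ j), ← h1, ← h2, ← Finset.sum_sub_distrib,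
        Finset.sum_filter]
      refine Finset.sum_congr rfl fun i _ => ?_
      split_ifs with ho
      · rw [ho.neg_one_pow]
        ring
      · rw [(Nat.not_odd_iff_even.1 ho).neg_one_pow]
        ring
    exact_mod_cast h3

theorem card_posOrbits_add {i : ℕ} (hi : i ≠ 0) (hiN : i ∣ N) :
    (posOrbits m N i).card + (if Even i then (negOrbits m N (i / 2)).card else 0) =
      (negOrbits m N i).card := by
  have := add_half_eq_of_signed_sum_eq_zero (N := N) (fun i => ((posOrbits m N i).card : ℤ))
    (fun i => ((negOrbits m N i).card : ℤ))
    (fun j hj hjN => sum_divisors_signed_card_orbits hj hjN) hi hiN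
  exact_mod_cast this

end OrbitCount

/-! ### Generating functions of orbits and truncated products. -/

section Series

theorem cycleTerm_eq (m i : ℕ) : cycleTerm m i =
    PowerSeries.C (MvPolynomial.C ((1 / (2 * (m : ℚ))) ^ i) * MvPolynomial.X i) *
      PowerSeries.X ^ i := by
  rw [cycleTerm, mul_pow, map_mul, map_pow, map_pow]
  ring

theorem coeff_mul_cycleTerm (m i k : ℕ) (G : CycleSeries) :
    PowerSeries.coeff k (G * cycleTerm m i) =
      if i ≤ k then MvPolynomial.C ((1 / (2 * (m : ℚ))) ^ i) * MvPolynomial.X i *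
        PowerSeries.coeff (k - i) G else 0 := by
  rw [cycleTerm_eq, mul_left_comm, PowerSeries.coeff_C_mul, PowerSeries.coeff_mul_X_pow']
  split_ifs <;> simp

theorem coeff_cycleTerm (m i k : ℕ) :
    PowerSeries.coeff k (cycleTerm m i) =
      if k = i then MvPolynomial.C ((1 / (2 * (m : ℚ))) ^ i) * MvPolynomial.X i else 0 := by
  rw [cycleTerm_eq, PowerSeries.coeff_C_mul, PowerSeries.coeff_X_pow, mul_ite, mul_one, mul_zero]

namespace PermOrbit

variable {E : Type*} [Fintype E] {S : Equiv.Perm E}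

/-- The generating function of the cycle monomials of an orbit. -/
noncomputable def series (m : ℕ) (s : E → ℤ) (O : PermOrbit S) : CycleSeries :=
  PowerSeries.mk fun k => if O.size ∣ k then
    MvPolynomial.C ((1 / (2 * (m : ℚ))) ^ k) * O.cycleMonomial s (k / O.size) else 0

theorem coeff_series_mul (m : ℕ) (s : E → ℤ) (O : PermOrbit S) (q : ℕ) :
    PowerSeries.coeff (O.size * q) (O.series m s) =
      MvPolynomial.C ((1 / (2 * (m : ℚ))) ^ (O.size * q)) * O.cycleMonomial s q := by
  rw [series, PowerSeries.coeff_mk, if_pos (dvd_mul_right _ _),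
    Nat.mul_div_cancel_left _ O.size_pos]

theorem coeff_series_of_not_dvd (m : ℕ) (s : E → ℤ) (O : PermOrbit S) {k : ℕ}
    (hk : ¬ O.size ∣ k) : PowerSeries.coeff k (O.series m s) = 0 := by
  rw [series, PowerSeries.coeff_mk, if_neg hk]

theorem cycleMonomial_zero (s : E → ℤ) (O : PermOrbit S) : O.cycleMonomial s 0 = 1 := by
  simp [cycleMonomial]

theorem series_mul_of_sign_eq_one (m : ℕ) {s : E → ℤ} {O : PermOrbit S} (hO : O.sign s = 1) :
    O.series m s * (1 - cycleTerm m O.size) = 1 := by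
  have hpos := O.size_pos
  ext1 k
  rw [mul_sub, mul_one, map_sub, coeff_mul_cycleTerm, PowerSeries.coeff_one]
  by_cases hk : O.size ∣ k
  · obtain ⟨q, rfl⟩ := hk
    rcases q with _ | q
    · rw [coeff_series_mul, cycleMonomial_zero, mul_zero, if_neg (by omega), if_pos rfl]
      simp
    · rw [if_pos (Nat.le_mul_of_pos_right _ q.succ_pos), if_neg (by positivity),
        mul_add O.size, mul_one, Nat.add_sub_cancel, ← mul_add_one, coeff_series_mul,
        coeff_series_mul, cycleMonomial, cycleMonomial, if_pos hO, if_pos hO, mul_add_one,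
        pow_add, pow_succ, map_mul]
      ring
  · have hk0 : k ≠ 0 := by rintro rfl; exact hk (dvd_zero _)
    rw [coeff_series_of_not_dvd m s O hk, if_neg hk0]
    split_ifs with h
    · rw [coeff_series_of_not_dvd, mul_zero, sub_zero]
      intro h'
      have := h'.add dvd_rfl
      rw [Nat.sub_add_cancel h] at this
      exact hk this
    · simp

/-- Raising the multiplicity by two multiplies the cycle monomial by `X (2 * O.size)`; only the
multiplicities `0` and `1` remain as the numerator. -/
theorem series_mul_of_sign_ne_one (m : ℕ) {s : E → ℤ} {O : PermOrbit S}
    (hO : ¬ O.sign s = 1) :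
    O.series m s * (1 - cycleTerm m (2 * O.size)) = 1 + cycleTerm m O.size := by
  have hpos := O.size_pos
  ext1 k
  rw [mul_sub, mul_one, map_sub, map_add, coeff_mul_cycleTerm, coeff_cycleTerm,
    PowerSeries.coeff_one]
  by_cases hk : O.size ∣ k
  · obtain ⟨q, rfl⟩ := hk
    rcases q with _ | _ | q
    · rw [coeff_series_mul, cycleMonomial_zero, mul_zero, if_neg (by omega), if_pos rfl,
        if_neg (by omega)]
      simp
    · rw [zero_add, coeff_series_mul, mul_one, if_neg (by omega), if_neg (by omega), if_pos rfl,
        cycleMonomial, if_neg hO]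
      simp
    · have h2 : O.size * (q + 1 + 1) = O.size * q + 2 * O.size := by ring
      have hne : ¬ O.size * q + 2 * O.size = O.size := by omega
      rw [coeff_series_mul, h2, if_pos (by omega), if_neg (by omega), if_neg hne,
        Nat.add_sub_cancel, coeff_series_mul, cycleMonomial, cycleMonomial, if_neg hO, if_neg hO,
        show q + 1 + 1 = q + 2 from rfl, Nat.add_mod_right, Nat.add_div_right _ two_pos,
        pow_add, pow_succ, map_mul]
      ring
  · have hk0 : k ≠ 0 := by rintro rfl; exact hk (dvd_zero _)
    have hk1 : k ≠ O.size := by rintro rfl; exact hk dvd_rfl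
    rw [coeff_series_of_not_dvd m s O hk, if_neg hk0, if_neg hk1]
    split_ifs with h
    · rw [coeff_series_of_not_dvd, mul_zero, sub_zero, add_zero]
      intro h'
      refine hk ?_
      have := h'.add (dvd_mul_left O.size 2)
      rwa [Nat.sub_add_cancel h] at this
    · simp

end PermOrbit

theorem coeff_shelfCycleSeries_eq_coeff_prod {m n N : ℕ} [NeZero N] (hN : n.factorial ∣ N) :
    PowerSeries.coeff n (shelfCycleSeries m) =
      PowerSeries.coeff n (∏ O : PermOrbit (shift (m := m) (N := N)), O.series m firstSign) := by
  rw [coeff_shelfCycleSeries, sum_prod_X_pow_numCycles hN, PowerSeries.coeff_prod,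
    Finset.mul_sum]
  refine Finset.sum_congr rfl fun l hl => ?_
  rw [← (Finset.mem_finsuppAntidiag.1 hl).1, ← Finset.prod_pow_eq_pow_sum, map_prod,
    ← Finset.prod_mul_distrib]
  refine Finset.prod_congr rfl fun O _ => ?_
  rw [PermOrbit.series, PowerSeries.coeff_mk, mul_ite, mul_zero]

/-- Group a product by the values of `ψ`, the large ones of which do not contribute. -/
theorem prod_filter_eq_prod_Icc_pow {ι M : Type*} [CommMonoid M] (F : Finset ι) (ψ : ι → ℕ)
    (φ : ℕ → M) {n : ℕ} (hψ : ∀ a ∈ F, 0 < ψ a) (hφ : ∀ i, n < i → φ i = 1) :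
    ∏ a ∈ F, φ (ψ a) = ∏ i ∈ Finset.Icc 1 n, φ i ^ (F.filter fun a => ψ a = i).card := by
  classical
  rw [← Finset.prod_filter_of_ne (p := fun a => ψ a ≤ n),
    ← Finset.prod_fiberwise_of_maps_to (s := F.filter fun a => ψ a ≤ n)
      (t := Finset.Icc 1 n) (g := ψ)]
  · refine Finset.prod_congr rfl fun i hi => ?_
    rw [Finset.filter_filter, Finset.prod_congr rfl (g := fun _ => φ i), Finset.prod_const]
    · congr 2
      refine Finset.filter_congr fun a _ => ⟨fun h => h.2, fun h => ⟨?_, h⟩⟩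
      rw [h]
      exact (Finset.mem_Icc.1 hi).2
    · intro a ha
      rw [(Finset.mem_filter.1 ha).2.2]
  · intro a ha
    obtain ⟨ha, ha'⟩ := Finset.mem_filter.1 ha
    exact Finset.mem_Icc.2 ⟨hψ a ha, ha'⟩
  · intro a _ hne
    by_contra h
    exact hne (hφ _ (by omega))

/-- Truncation at degree `n`. -/
noncomputable abbrev truncHom (n : ℕ) : CycleSeries →+*
    CycleSeries ⧸ Ideal.span {(PowerSeries.X : CycleSeries) ^ (n + 1)} :=
  Ideal.Quotient.mk _

theorem coeff_eq_of_truncHom_eq {n : ℕ} {A B : CycleSeries} (h : truncHom n A = truncHom n B) :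
    PowerSeries.coeff n A = PowerSeries.coeff n B := by
  rw [Ideal.Quotient.mk_eq_mk_iff_sub_mem, Ideal.mem_span_singleton,
    PowerSeries.X_pow_dvd_iff] at h
  have := h n (Nat.lt_succ_self n)
  rwa [map_sub, sub_eq_zero] at this

theorem truncHom_cycleTerm (m : ℕ) {n i : ℕ} (h : n < i) : truncHom n (cycleTerm m i) = 0 := by
  rw [Ideal.Quotient.eq_zero_iff_mem, Ideal.mem_span_singleton, cycleTerm_eq]
  exact (pow_dvd_pow _ h).mul_left _

theorem isUnit_one_sub_cycleTerm (m : ℕ) {i : ℕ} (hi : 1 ≤ i) : IsUnit (1 - cycleTerm m i) := by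
  rw [PowerSeries.isUnit_iff_constantCoeff]
  simp [cycleTerm, Nat.ne_of_gt hi]

theorem truncHom_cycleFactor (m : ℕ) {n i : ℕ} (h : n < i) :
    truncHom n (cycleFactor m i) = 1 := by
  have := congrArg (truncHom n) (cycleFactor_mul m i (by omega))
  simpa [truncHom_cycleTerm m h] using this

theorem truncHom_prod_cycleFactor_mul (m n : ℕ) (f : ℕ → ℕ) (T : Finset ℕ+)
    (hT : ∀ i : ℕ+, (i : ℕ) ≤ n → i ∈ T) :
    truncHom n (∏ i ∈ T, cycleFactor m i ^ f i) *
      ∏ i ∈ Finset.Icc 1 n, (1 - truncHom n (cycleTerm m i)) ^ f i =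
      ∏ i ∈ Finset.Icc 1 n, (1 + truncHom n (cycleTerm m i)) ^ f i := by
  have h1 : truncHom n (∏ i ∈ T, cycleFactor m i ^ f i) =
      ∏ i ∈ Finset.Icc 1 n, truncHom n (cycleFactor m i) ^ f i := by
    rw [map_prod]
    simp only [map_pow]
    refine (Finset.prod_map T ⟨((↑) : ℕ+ → ℕ), PNat.coe_injective⟩
      (fun i => truncHom n (cycleFactor m i) ^ f i)).symm.trans ?_
    symm
    refine Finset.prod_subset ?_ ?_
    · intro i hi
      rw [Finset.mem_Icc] at hi
      exact Finset.mem_map.2 ⟨⟨i, hi.1⟩, hT _ hi.2, rfl⟩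
    · intro i hi hi'
      obtain ⟨j, -, rfl⟩ := Finset.mem_map.1 hi
      rw [Finset.mem_Icc] at hi'
      have := j.pos
      rw [truncHom_cycleFactor, one_pow]
      simp only [Function.Embedding.coeFn_mk] at hi' ⊢
      omega
  rw [h1, ← Finset.prod_mul_distrib]
  refine Finset.prod_congr rfl fun i hi => ?_
  rw [← mul_pow, ← map_one (truncHom n), ← map_sub, ← map_mul,
    cycleFactor_mul m i (Finset.mem_Icc.1 hi).1, map_add]

/-- Modulo `u^(n+1)` only indices `i ≤ n` matter, and these divide `n!`, so the orbit counts apply.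
The denominator factors with index `i` come from positive orbits of size `i` and negative ones of
size `i / 2`, together `f i`. -/
theorem truncHom_prod_series_mul (m n : ℕ) [NeZero n.factorial] (f : ℕ → ℕ)
    (hf : ∀ i, i ≠ 0 → (f i : ℚ) = shelfExponent i m) :
    truncHom n (∏ O : PermOrbit (shift (m := m) (N := n.factorial)), O.series m firstSign) *
      ∏ i ∈ Finset.Icc 1 n, (1 - truncHom n (cycleTerm m i)) ^ f i =
      ∏ i ∈ Finset.Icc 1 n, (1 + truncHom n (cycleTerm m i)) ^ f i := by
  set Ω := (Finset.univ : Finset (PermOrbit (shift (m := m) (N := n.factorial)))) with hΩ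
  set pos := Ω.filter fun O => O.sign firstSign = 1 with hpos
  set neg := Ω.filter fun O => ¬ O.sign firstSign = 1 with hneg
  have hdvd : ∀ i ∈ Finset.Icc 1 n, i ≠ 0 ∧ i ∣ n.factorial := fun i hi => by
    rw [Finset.mem_Icc] at hi
    exact ⟨by omega, Nat.dvd_factorial hi.1 hi.2⟩
  have hnegcard : ∀ i ∈ Finset.Icc 1 n, (negOrbits m n.factorial i).card = f i := fun i hi => by
    have := card_negOrbits (m := m) (hdvd i hi).1 (hdvd i hi).2
    rw [← hf i (hdvd i hi).1] at this
    exact_mod_cast this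
  have hminus : ∀ i, n < i → 1 - truncHom n (cycleTerm m i) = 1 := fun i hi => by
    rw [truncHom_cycleTerm m hi, sub_zero]
  have hplus : ∀ i, n < i → 1 + truncHom n (cycleTerm m i) = 1 := fun i hi => by
    rw [truncHom_cycleTerm m hi, add_zero]
  have hden : ∏ i ∈ Finset.Icc 1 n, (1 - truncHom n (cycleTerm m i)) ^ f i =
      (∏ O ∈ pos, (1 - truncHom n (cycleTerm m O.size))) *
        ∏ O ∈ neg, (1 - truncHom n (cycleTerm m (2 * O.size))) := by
    rw [prod_filter_eq_prod_Icc_pow pos (fun O => O.size)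
        (fun i => 1 - truncHom n (cycleTerm m i)) (fun O _ => O.size_pos) hminus,
      prod_filter_eq_prod_Icc_pow neg (fun O => 2 * O.size)
        (fun i => 1 - truncHom n (cycleTerm m i))
        (fun O _ => Nat.mul_pos two_pos O.size_pos) hminus,
      ← Finset.prod_mul_distrib]
    refine Finset.prod_congr rfl fun i hi => ?_
    rw [← pow_add, ← hnegcard i hi, ← card_posOrbits_add (hdvd i hi).1 (hdvd i hi).2, hpos, hneg,
      Finset.filter_filter, Finset.filter_filter]
    congr 2
    split_ifs with hev
    · obtain ⟨k, rfl⟩ := even_iff_two_dvd.1 hev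
      rw [Nat.mul_div_cancel_left _ two_pos, negOrbits]
      congr 1
      refine Finset.filter_congr fun O _ => and_congr_right fun _ => ?_
      omega
    · symm
      rw [Finset.card_eq_zero, Finset.filter_eq_empty_iff]
      rintro O - ⟨-, h⟩
      exact hev (h ▸ even_two_mul _)
  have hnum : ∏ i ∈ Finset.Icc 1 n, (1 + truncHom n (cycleTerm m i)) ^ f i =
      ∏ O ∈ neg, (1 + truncHom n (cycleTerm m O.size)) := by
    rw [prod_filter_eq_prod_Icc_pow neg (fun O => O.size)
        (fun i => 1 + truncHom n (cycleTerm m i)) (fun O _ => O.size_pos) hplus]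
    refine Finset.prod_congr rfl fun i hi => ?_
    rw [← hnegcard i hi, hneg, Finset.filter_filter, negOrbits]
  rw [hden, hnum, ← Finset.prod_filter_mul_prod_filter_not Ω (fun O => O.sign firstSign = 1),
    map_mul, mul_mul_mul_comm, map_prod, map_prod, ← Finset.prod_mul_distrib,
    ← Finset.prod_mul_distrib]
  rw [Finset.prod_eq_one, one_mul]
  · refine Finset.prod_congr rfl fun O hO => ?_
    rw [← map_one (truncHom n), ← map_sub, ← map_mul,
      PermOrbit.series_mul_of_sign_ne_one m (Finset.mem_filter.1 hO).2, map_add]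
  · intro O hO
    rw [← map_one (truncHom n), ← map_sub, ← map_mul,
      PermOrbit.series_mul_of_sign_eq_one m (Finset.mem_filter.1 hO).2]

/-- The truncated products of orbit series and of cycle factors become equal after multiplication by
the same unit, the common denominator. -/
theorem coeff_prod_cycleFactor (m n : ℕ) (f : ℕ → ℕ)
    (hf : ∀ i, i ≠ 0 → (f i : ℚ) = shelfExponent i m) (T : Finset ℕ+)
    (hT : ∀ i : ℕ+, (i : ℕ) ≤ n → i ∈ T) :
    PowerSeries.coeff n (∏ i ∈ T, cycleFactor m i ^ f i) =
      PowerSeries.coeff n (shelfCycleSeries m) := by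
  have : NeZero n.factorial := ⟨n.factorial_ne_zero⟩
  rw [coeff_shelfCycleSeries_eq_coeff_prod (m := m) (dvd_refl n.factorial)]
  refine coeff_eq_of_truncHom_eq ?_
  have hunit : IsUnit (∏ i ∈ Finset.Icc 1 n, (1 - truncHom n (cycleTerm m i)) ^ f i) := by
    rw [IsUnit.prod_iff]
    intro i hi
    refine IsUnit.pow _ ?_
    rw [← map_one (truncHom n), ← map_sub]
    exact (isUnit_one_sub_cycleTerm m (Finset.mem_Icc.1 hi).1).map (truncHom n)
  refine hunit.mul_right_cancel ?_
  rw [truncHom_prod_cycleFactor_mul m n f T hT, truncHom_prod_series_mul m n f hf]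

end Series

/-! ### Convergence and conclusion. -/

theorem hasFormalProd_of_coeff_eventually_eq {R ι : Type*} [CommRing R] {F : ι → PowerSeries R}
    {G : PowerSeries R}
    (h : ∀ n, ∃ T₀ : Finset ι, ∀ T, T₀ ⊆ T →
      PowerSeries.coeff n (∏ i ∈ T, F i) = PowerSeries.coeff n G) :
    HasFormalProd F G := by
  let _ : TopologicalSpace R := ⊥
  let _ : TopologicalSpace (PowerSeries R) := PowerSeries.WithPiTopology.instTopologicalSpace R
  change HasProd F G
  rw [HasProd, SummationFilter.unconditional_filter,
    PowerSeries.WithPiTopology.tendsto_iff_coeff_tendsto]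
  intro n
  obtain ⟨T₀, hT₀⟩ := h n
  refine tendsto_const_nhds.congr' ?_
  filter_upwards [Filter.eventually_ge_atTop T₀] with T hT
  exact (hT₀ T hT).symm

/-- Words of period `N = i` already contain all orbits of length `i`, so the exponent is the number
of negative ones. -/
theorem exists_shelfExponent_eq (m i : ℕ) (hi : i ≠ 0) :
    ∃ f : ℕ, (f : ℚ) = shelfExponent i m :=
  have : NeZero i := ⟨hi⟩
  ⟨_, card_negOrbits (m := m) (N := i) hi dvd_rfl⟩

theorem theorem3p4 (m : ℕ) (hm : 1 ≤ m) :
    ∃ f : ℕ+ → ℕ, (∀ i : ℕ+, (f i : ℚ) = shelfExponent i m) ∧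
      HasFormalProd (fun i : ℕ+ => cycleFactor m i ^ f i) (shelfCycleSeries m) := by
  have hex : ∀ i : ℕ, ∃ f : ℕ, i ≠ 0 → (f : ℚ) = shelfExponent i m := fun i => by
    by_cases hi : i = 0
    · exact ⟨0, fun h => absurd hi h⟩
    · obtain ⟨f, hf⟩ := exists_shelfExponent_eq m i hi
      exact ⟨f, fun _ => hf⟩
  choose f hf using hex
  refine ⟨fun i => f i, fun i => hf i i.ne_zero, hasFormalProd_of_coeff_eventually_eq fun n => ?_⟩
  -- The bound is `n + 1` because `n` may be `0`, which is not in `ℕ+`; any set containing all `i ≤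
  -- n` works.
  refine ⟨Finset.Icc 1 n.succPNat, fun T hT => ?_⟩
  refine coeff_prod_cycleFactor m n f hf T fun i hi => hT ?_
  rw [Finset.mem_Icc, ← PNat.coe_le_coe, ← PNat.coe_le_coe, Nat.succPNat_coe]
  exact ⟨i.pos, hi.trans (Nat.le_succ n)⟩
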